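/- **Setting.** Let $\mathbb K\in\{\mathbb R,\mathbb C\}$ and let $y=(y_1,\dots,y_Q)$ be a random parameter with independent components, $y_q$ having a probability density $\rho_q$ on $[-\gamma_q,\gamma_q]$; write $\Lambda=\prod_q[-\gamma_q,\gamma_q]$, and let $E[\cdot]$, $V[\cdot]$ be expectation and variance under the law of $y$. Let $W$ be a finite-dimensional $\mathbb K$-vector space (for instance an HDG approximation space), let $a(v,w;y)=a^0(v,w)+\sum_{q=1}^Q y_q\,a^q(v,w)$ with forms $a^q$, $0\le q\le Q$, that are linear in $v$ and conjugate-linear in $w$, let $b$ be a conjugate-linear and $\ell_{\rm out}$ a linear functional on $W$. For $y\in\Lambda$ let $u_h(y)\in W$ be the solution of $a(u_h,w;y)=b(w)$ for all $w\in W$, and put $s_h(y)=\ell_{\rm out}(u_h(y))$. Given primal and dual reduced basis functions in $W$, let $W_N^{\rm pr}$, $W_N^{\rm du}$ be the spans of the first $N$ of them, let $u_N(y)\in W_N^{\rm pr}$ and $\phi_N(y)\in W_N^{\rm du}$ be the Galerkin solutions of $a(u_N,w;y)=b(w)$ for all $w\in W_N^{\rm pr}$ and $a(w,\phi_N;y)=-\ell_{\rm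 out}(w)$ for all $w\in W_N^{\rm du}$, and put $s_N(y)=\ell_{\rm out}(u_N)+a(u_N,\phi_N;y)-b(\phi_N)$. (If the scalars are complex, the outputs are the real parts of these expressions.) Fix $L\ge 0$ and reduced basis dimensions $N_1,\dots,N_L$, write $s_0=s_h$ and $s_\ell=s_{N_\ell}$ for $1\le\ell\le L$, and assume that for every $y\in\Lambda$ the problems defining $s_0,\dots,s_L$ are uniquely solvable. For functions $f_0,\dots,f_L$ of $y$ write $D_\ell f=f_\ell-f_{\ell+1}$ for $\ell<L$ and $D_Lf=f_L$. Let $y^\ell_m$ ($0\le\ell\le L$, $m\ge 1$) be independent samples with the law of $y$, and for a function $g$ let $$E_{M_\ell}[g]=\frac1{M_\ell}\sum_{m=1}^{M_\ell}g(y^\ell_m),\qquad V_{M_\ell}[g]=\frac1{M_\ell-1}\sum_{m=1}^{M_\ell}\bigl(E_{M_\ell}[g]-g(y^\ell_m)\bigr)^2 .$$ Put $E_{M_0,\dots,M_L}[s_h]=\sum_{\ell=0}^L E_{M_\ell}[D_\ell s]$, $\ \zeta_\ell=\bigl(s_\ell-E_{M_0,\dots,M_L}[s_h]\bigr)^2$,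 and $$V_{M_0,\dots,M_L}[s_h]=\sum_{\ell=0}^L E_{M_\ell}[D_\ell\zeta],\qquad \Delta^V_{M_0,\dots,M_L}=a\sqrt{\sum_{\ell=0}^L\frac{V_{M_\ell}[D_\ell\zeta]}{M_\ell}} .$$ **Statement.** Let $\widehat\zeta_\ell=(s_\ell-E[s_h])^2$ and assume $V[D_0\widehat\zeta]>0$ (that is, $V[\widehat\zeta_0-\widehat\zeta_1]>0$ if $L\ge1$, and $V[\widehat\zeta_0]>0$ if $L=0$). Then for every $a>0$ the iterated limit, taken first in $M_L$, then in $M_{L-1}$, and so on, and last in $M_0$, exists and $$\lim_{M_0\to\infty}\cdots\lim_{M_L\to\infty}\Pr\Bigl(\bigl|V[s_h]-V_{M_0,\dots,M_L}[s_h]\bigr|\le\Delta^V_{M_0,\dots,M_L}\Bigr)=\operatorname{erf}\!\left(\frac a{\sqrt2}\right).$$ -/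

import Mathlib

open MeasureTheory ProbabilityTheory Filter Topology
open scoped NNReal ENNReal

noncomputable section

namespace LMVR

/-- The error function `erf x = (2 / √π) ∫₀ˣ exp (-t²) dt`. -/
def erf (x : ℝ) : ℝ := 2 / Real.sqrt Real.pi * ∫ t in (0 : ℝ)..x, Real.exp (-t ^ 2)

/-! ### The random parameter -/

/-- The parameter box `Λ = ∏ q, [-γ q, γ q]`. -/
def box {Q : ℕ} (γ : Fin Q → ℝ) : Set (Fin Q → ℝ) :=
  Set.univ.pi fun q => Set.Icc (-γ q) (γ q)

/-- The law `ρ(y) dy`, `ρ(y) = ∏ q, ρ q (y q)`, of the parameter on the box: the components are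
independent and the `q`-th one has density `ρ q` on `[-γ q, γ q]`. -/
def paramLaw {Q : ℕ} (γ : Fin Q → ℝ) (ρ : Fin Q → ℝ → ℝ≥0) : Measure (Fin Q → ℝ) :=
  Measure.pi fun q =>
    (volume.restrict (Set.Icc (-γ q) (γ q))).withDensity fun t => (ρ q t : ℝ≥0∞)

/-! ### The discrete problem with affine parameter dependence and its Galerkin approximations -/

/-- A discretized variational problem `a(u, w; y) = b(w)` on a space `W`, with a form that is
affine in the parameter, `a(v, w; y) = a⁰(v, w) + ∑ q, y q * a^q(v, w)`, and with an output
functional `ℓ`. Forms are linear in the first and conjugate-linear in the second argument. -/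
structure AffineProblem (𝕜 : Type*) [RCLike 𝕜] (Q : ℕ) (W : Type*) [AddCommGroup W]
    [Module 𝕜 W] where
  /-- the parameter-independent part `a⁰` -/
  a₀ : W →ₗ[𝕜] W →ₗ⋆[𝕜] 𝕜
  /-- the forms `a^q` -/
  a₁ : Fin Q → W →ₗ[𝕜] W →ₗ⋆[𝕜] 𝕜
  /-- the right-hand side -/
  b : W →ₗ⋆[𝕜] 𝕜
  /-- the output functional -/
  out : W →ₗ[𝕜] 𝕜

namespace AffineProblem

variable {𝕜 : Type*} [RCLike 𝕜] {Q : ℕ} {W : Type*} [AddCommGroup W] [Module 𝕜 W]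

/-- The form `a(v, w; y)`. -/
def form (A : AffineProblem 𝕜 Q W) (y : Fin Q → ℝ) (v w : W) : 𝕜 :=
  A.a₀ v w + ∑ q, (y q : 𝕜) * A.a₁ q v w

/-- `u ∈ V` and `a(u, w; y) = b(w)` for all `w ∈ V`. -/
def IsPrimal (A : AffineProblem 𝕜 Q W) (V : Submodule 𝕜 W) (y : Fin Q → ℝ) (u : W) : Prop :=
  u ∈ V ∧ ∀ w ∈ V, A.form y u w = A.b w

/-- `φ ∈ V` and `a(w, φ; y) = -ℓ(w)` for all `w ∈ V`. -/
def IsDual (A : AffineProblem 𝕜 Q W) (V : Submodule 𝕜 W) (y : Fin Q → ℝ) (φ : W) : Prop :=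
  φ ∈ V ∧ ∀ w ∈ V, A.form y w φ = -A.out w

open Classical in
/-- The Galerkin solution of the primal problem in `V` (`0` if there is none). -/
def primal (A : AffineProblem 𝕜 Q W) (V : Submodule 𝕜 W) (y : Fin Q → ℝ) : W :=
  if h : ∃ u, A.IsPrimal V y u then h.choose else 0

open Classical in
/-- The Galerkin solution of the dual problem in `V` (`0` if there is none). -/
def dual (A : AffineProblem 𝕜 Q W) (V : Submodule 𝕜 W) (y : Fin Q → ℝ) : W :=
  if h : ∃ φ, A.IsDual V y φ then h.choose else 0

/-- The high-fidelity output `s_h(y) = ℓ(u_h(y))`; outputs are real, so the real part is taken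
when the scalars are complex. -/
def fullOutput (A : AffineProblem 𝕜 Q W) (y : Fin Q → ℝ) : ℝ :=
  RCLike.re (A.out (A.primal ⊤ y))

/-- The primal-dual reduced basis output
`s_N(y) = ℓ(u_N(y)) + a(u_N(y), φ_N(y); y) - b(φ_N(y))`, with `u_N(y) ∈ Vpr`, `φ_N(y) ∈ Vdu`. -/
def rbOutput (A : AffineProblem 𝕜 Q W) (Vpr Vdu : Submodule 𝕜 W) (y : Fin Q → ℝ) : ℝ :=
  RCLike.re (A.out (A.primal Vpr y) + A.form y (A.primal Vpr y) (A.dual Vdu y)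
    - A.b (A.dual Vdu y))

end AffineProblem

/-- The reduced basis space spanned by the first `N` basis functions. -/
def rbSpace (𝕜 : Type*) [RCLike 𝕜] {W : Type*} [AddCommGroup W] [Module 𝕜 W]
    (z : ℕ → W) (N : ℕ) : Submodule 𝕜 W :=
  Submodule.span 𝕜 (z '' Set.Iio N)

/-- The outputs `s_h, s_{N_1}, …, s_{N_L}`, with index `0` for `s_h` and `ℓ` for `s_{N_ℓ}`. -/
def outputs {𝕜 : Type*} [RCLike 𝕜] {Q : ℕ} {W : Type*} [AddCommGroup W] [Module 𝕜 W]
    (A : AffineProblem 𝕜 Q W) (zpr zdu : ℕ → W) {L : ℕ} (N : Fin L → ℕ) :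
    Fin (L + 1) → (Fin Q → ℝ) → ℝ :=
  Fin.cons (α := fun _ => (Fin Q → ℝ) → ℝ) A.fullOutput
    fun ℓ => A.rbOutput (rbSpace 𝕜 zpr (N ℓ)) (rbSpace 𝕜 zdu (N ℓ))

/-! ### Multilevel Monte Carlo estimates -/

section Estimates

variable {Θ : Type*} {L : ℕ}

/-- The level quantities of a family `f 0, …, f L`:
`f ℓ - f (ℓ + 1)` for `ℓ < L`, and `f L` for `ℓ = L`. -/
def level (f : Fin (L + 1) → Θ → ℝ) (ℓ : Fin (L + 1)) (y : Θ) : ℝ :=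
  if h : (ℓ : ℕ) + 1 < L + 1 then f ℓ y - f ⟨ℓ + 1, h⟩ y else f ℓ y

/-- The Monte Carlo mean `E_M[f] = (1 / M) ∑ f(y_m)` over the first `M` samples. -/
def mcMean (M : ℕ) (x : ℕ → Θ) (f : Θ → ℝ) : ℝ :=
  (∑ m ∈ Finset.range M, f (x m)) / M

/-- The Monte Carlo variance `V_M[f] = (1 / (M - 1)) ∑ (E_M[f] - f(y_m))²`. -/
def mcVar (M : ℕ) (x : ℕ → Θ) (f : Θ → ℝ) : ℝ :=
  (∑ m ∈ Finset.range M, (mcMean M x f - f (x m)) ^ 2) / ((M : ℝ) - 1)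

/-- `∑ ℓ, E_{M_ℓ}[level ℓ of f]`, where level `ℓ` uses its own samples `x ℓ`. -/
def mlMean (M : Fin (L + 1) → ℕ) (x : Fin (L + 1) → ℕ → Θ) (f : Fin (L + 1) → Θ → ℝ) : ℝ :=
  ∑ ℓ, mcMean (M ℓ) (x ℓ) (level f ℓ)

/-- The squared deviations `(s_ℓ - c)²` of the outputs from a number `c`. -/
def sqDev (s : Fin (L + 1) → Θ → ℝ) (c : ℝ) : Fin (L + 1) → Θ → ℝ :=
  fun ℓ y => (s ℓ y - c) ^ 2

/-- The multilevel variance estimate `V_{M_0,…,M_L}[s_h]`, built on the squared deviations from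
the multilevel estimate `E_{M_0,…,M_L}[s_h]` of the mean. -/
def mlVar (M : Fin (L + 1) → ℕ) (x : Fin (L + 1) → ℕ → Θ) (s : Fin (L + 1) → Θ → ℝ) : ℝ :=
  mlMean M x (sqDev s (mlMean M x s))

/-- The error bound `Δ^V_{M_0,…,M_L}`. -/
def varBound (a : ℝ) (M : Fin (L + 1) → ℕ) (x : Fin (L + 1) → ℕ → Θ)
    (s : Fin (L + 1) → Θ → ℝ) : ℝ :=
  a * Real.sqrt (∑ ℓ, mcVar (M ℓ) (x ℓ) (level (sqDev s (mlMean M x s)) ℓ) / M ℓ)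

end Estimates

/-- `IsIteratedLimit n F c`: the iterated limit
`lim_{M_0 → ∞} (lim_{M_1 → ∞} (… lim_{M_{n-1} → ∞} F(M_0, …, M_{n-1})))` exists and equals `c`.
The innermost limit is in the last variable. -/
def IsIteratedLimit : (n : ℕ) → ((Fin n → ℕ) → ℝ) → ℝ → Prop
  | 0, F, c => F Fin.elim0 = c
  | n + 1, F, c => ∃ g : ℕ → ℝ,
      (∀ᶠ m in atTop, IsIteratedLimit n (fun M => F (Fin.cons (α := fun _ => ℕ) m M)) (g m)) ∧
        Tendsto g atTop (𝓝 c)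

end LMVR

end

/-!
Let `c` be the multilevel estimate of the mean. As the level quantities telescope, the variance
estimate equals `E[s²] - c²` with multilevel means `E`, so both the error of the estimate and the
square of the bound are polynomials in the sampled outputs. The event is therefore `X ≤ 0` for a
polynomial `X`, the difference of the squared error and the squared bound (`hybridGap`,
`abs_sub_mlVar_le_varBound_iff`).

Inner limits. By the strong law of large numbers, `M_k → ∞` turns the sample means on level `k` into
exact means and removes the `k`-th term of the bound (`tendsto_hybridGap`). The probability of
`X ≤ 0` converges along with `X` only if the limit of `X` has no atom at `0`. This is where the
parametrized problem enters: by Cramer's rule the outputs are rational functions of the parameter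
without poles on the box (`rationalOn_outputs`), so a polynomial in the sampled outputs is almost
surely nonzero as soon as it is nonzero at one point (`ae_ne_zero_of_sections`,
`ae_evalAt_ne_zero`). Such a point is found among the samples that are constant in each level, where
the bound vanishes: were the error zero at all of these, then the level-`0` variance of the squared
deviations would be zero (`exists_hybridDefect_ne_zero`).

Outermost limit. With only level `0` sampled, `M_0` times `X` is `(T - R)² - a² S`. Here `T` is the
scaled sample mean of a centred variable and is asymptotically Gaussian by the central limit
theorem, `R` is `√M_0` times the squared error of a sample mean and tends to `0` in probability, and
`S` is a sample variance that tends to the variance of the Gaussian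
(`tendsto_measure_hybridGap_one_nonpos`). The limit is the probability that a standard Gaussian is
at most `a` in absolute value.
-/

namespace LMVR

noncomputable section

/-! ### Iterated limits -/

/-- An iterated limit can be computed one variable at a time: `G k M` is the value after the limits
in the variables `k, …, n - 1` have been taken, and depends on the variables below `k` only. The
limit hypothesis is needed only where all variables are positive. -/
theorem isIteratedLimit_of_partialLimits (n : ℕ) (F : (Fin n → ℕ) → ℝ)
    (G : ℕ → (Fin n → ℕ) → ℝ) (c : ℝ) (h0 : ∀ M, G 0 M = c)
    (hF : ∀ M, (∀ i, 0 < M i) → F M = G n M)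
    (hdep : ∀ k M M', (∀ i : Fin n, (i : ℕ) < k → M i = M' i) → G k M = G k M')
    (hlim : ∀ (k : Fin n) (M : Fin n → ℕ), (∀ i, 0 < M i) →
      Tendsto (fun m => G (k + 1) (Function.update M k m)) atTop (𝓝 (G k M))) :
    IsIteratedLimit n F c := by
  induction n generalizing c with
  | zero => exact (hF _ fun i => i.elim0).trans (h0 _)
  | succ n ih =>
    refine ⟨fun m => G 1 (Fin.cons (α := fun _ => ℕ) m fun _ => 1), ?_, ?_⟩
    · filter_upwards [eventually_gt_atTop 0] with m hm
      have hpos : ∀ M : Fin n → ℕ, (∀ i, 0 < M i) →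
          ∀ i, 0 < (Fin.cons (α := fun _ => ℕ) m M : Fin (n + 1) → ℕ) i := fun M hM i => by
        cases i using Fin.cases <;> simp [hm, hM]
      refine ih _ (fun k M => G (k + 1) (Fin.cons (α := fun _ => ℕ) m M)) _ ?_ ?_ ?_ ?_
      · intro M
        refine hdep _ _ _ fun i hi => ?_
        have : i = 0 := Fin.ext (by simpa using hi)
        subst this
        simp
      · exact fun M hM => hF _ (hpos M hM)
      · intro k M M' h
        refine hdep _ _ _ fun i hi => ?_
        cases i using Fin.cases with
        | zero => simp
        | succ j => simpa using h j (by simpa using hi)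
      · intro k M hM
        have := hlim k.succ _ (hpos M hM)
        simpa [Fin.cons_update] using this
    · have := hlim 0 (fun _ => 1) (fun _ => one_pos)
      simp only [Fin.val_zero, h0, zero_add] at this
      refine this.congr fun m => hdep _ _ _ fun i hi => ?_
      have : i = 0 := Fin.ext (by simpa using hi)
      subst this
      simp

/-! ### Null sets of functions of independent variables -/

/-- Suppose that every function in the class `𝒜` that is nonzero somewhere on `B` is almost surely
nonzero at each `Y i`. Then a function of finitely many of the independent variables `Y i` whose
one-variable sections lie in `𝒜` has the same property: it suffices that it is nonzero at one point
with coordinates in `B`. The proof is Fubini's theorem and induction on the number of variables. -/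
theorem ae_ne_zero_of_sections {ι Θ E Ω : Type*} [DecidableEq ι] [MeasurableSpace Θ]
    [MeasurableSpace Ω] [Zero E] [MeasurableSpace E] [MeasurableSingletonClass E]
    {P : Measure Ω} [IsProbabilityMeasure P] {Y : ι → Ω → Θ} (hY : ∀ i, Measurable (Y i))
    (hindep : iIndepFun Y P) {𝒜 : Set (Θ → E)} {B : Set Θ}
    (hconst : ∀ c : E, (fun _ => c) ∈ 𝒜)
    (h𝒜 : ∀ i, ∀ f ∈ 𝒜, (∃ t ∈ B, f t ≠ 0) → ∀ᵐ t ∂P.map (Y i), f t ≠ 0)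
    {y₀ : ι → Θ} (hy₀ : ∀ i, y₀ i ∈ B) (S : Finset ι) (Φ : (ι → Θ) → E) (hΦ : Measurable Φ)
    (hsec : ∀ y i, (fun t => Φ (Function.update y i t)) ∈ 𝒜)
    (hdep : ∀ y y', (∀ i ∈ S, y i = y' i) → Φ y = Φ y') (hne : Φ y₀ ≠ 0) :
    ∀ᵐ ω ∂P, Φ (fun i => Y i ω) ≠ 0 := by
  induction S using Finset.induction_on generalizing Φ with
  | empty => exact .of_forall fun ω => by rwa [hdep _ y₀ (by simp)]
  | insert i S hi ih =>
    -- freeze the coordinate `i` at a value `t` for which the section does not vanish at `y₀`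
    have h1 : ∀ᵐ t ∂P.map (Y i), Φ (Function.update y₀ i t) ≠ 0 :=
      h𝒜 i _ (hsec y₀ i) ⟨y₀ i, hy₀ i, by simpa using hne⟩
    have h2 : ∀ᵐ t ∂P.map (Y i), ∀ᵐ ω ∂P, Φ (Function.update (fun j => Y j ω) i t) ≠ 0 := by
      filter_upwards [h1] with t ht
      refine ih (fun y => Φ (Function.update y i t)) ?_ ?_ ?_ ht
      · refine hΦ.comp (measurable_pi_lambda _ fun j => ?_)
        rcases eq_or_ne j i with rfl | hj
        · simp
        · simpa [hj] using measurable_pi_apply j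
      · intro y j
        rcases eq_or_ne j i with rfl | hj
        · simpa using hconst _
        · simpa only [Function.update_comm hj] using hsec (Function.update y i t) j
      · intro y y' h
        refine hdep _ _ fun j hj => ?_
        rcases eq_or_ne j i with rfl | hji
        · simp
        · simpa [hji] using h j (Finset.mem_of_mem_insert_of_ne hj hji)
    -- the coordinate `i` is independent of the coordinates in `S`
    let Z : Ω → (S → Θ) := fun ω j => Y j ω
    let ext : (S → Θ) → ι → Θ := fun z j => if h : j ∈ S then z ⟨j, h⟩ else y₀ j
    have hZ : Measurable Z := measurable_pi_lambda _ fun j => hY j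
    have hYZ : IndepFun (Y i) Z P := by
      have := hindep.indepFun_finset {i} S (by simpa using hi) hY
      exact this.comp (φ := fun z : ({i} : Finset ι) → Θ => z ⟨i, by simp⟩) (ψ := id)
        (measurable_pi_apply _) measurable_id
    have hΨ : Measurable fun p : Θ × (S → Θ) => Φ (Function.update (ext p.2) i p.1) := by
      refine hΦ.comp (measurable_pi_lambda _ fun j => ?_)
      rcases eq_or_ne j i with rfl | hj
      · simpa using measurable_fst
      · by_cases hjS : j ∈ S
        · simp only [ne_eq, hj, not_false_eq_true, Function.update_of_ne, ext, hjS, dite_true]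
          fun_prop
        · simp [hj, ext, hjS]
    have hext : ∀ t ω, Φ (Function.update (ext (Z ω)) i t)
        = Φ (Function.update (fun j => Y j ω) i t) := fun t ω => by
      refine hdep _ _ fun j hj => ?_
      rcases eq_or_ne j i with rfl | hji
      · simp
      · simp [hji, ext, Z, Finset.mem_of_mem_insert_of_ne hj hji]
    have hset : MeasurableSet {p : Θ × (S → Θ) | Φ (Function.update (ext p.2) i p.1) ≠ 0} :=
      (hΨ (measurableSet_singleton 0)).compl
    have := (indepFun_iff_map_prod_eq_prod_map_map (hY i).aemeasurable hZ.aemeasurable).1 hYZ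
    have h3 : ∀ᵐ p ∂P.map (fun ω => (Y i ω, Z ω)), Φ (Function.update (ext p.2) i p.1) ≠ 0 := by
      have := Measure.isProbabilityMeasure_map (μ := P) hZ.aemeasurable
      rw [‹P.map (fun ω => (Y i ω, Z ω)) = _›, Measure.ae_prod_iff_ae_ae hset]
      filter_upwards [h2] with t ht
      refine (ae_map_iff hZ.aemeasurable (hset.preimage (measurable_prodMk_left (x := t)))).2 ?_
      simpa only [Set.mem_preimage, Set.mem_ofPred_eq, hext] using ht
    have h4 := ae_of_ae_map ((hY i).prodMk hZ).aemeasurable h3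
    filter_upwards [h4] with ω hω
    rw [hext] at hω
    simpa using hω

/-! ### Level quantities and sample moments -/

section Level

variable {Θ : Type*} {L : ℕ}

theorem level_castSucc (f : Fin (L + 1) → Θ → ℝ) (i : Fin L) (y : Θ) :
    level f i.castSucc y = f i.castSucc y - f i.succ y := by
  simp [level, Fin.succ]

theorem level_last (f : Fin (L + 1) → Θ → ℝ) (y : Θ) :
    level f (Fin.last L) y = f (Fin.last L) y := by
  simp [level]

/-- The level quantities telescope. -/
theorem sum_level (f : Fin (L + 1) → Θ → ℝ) (y : Θ) : ∑ ℓ, level f ℓ y = f 0 y := by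
  have h1 := Fin.sum_univ_castSucc fun ℓ => f ℓ y
  have h2 := Fin.sum_univ_succ fun ℓ => f ℓ y
  simp only [Fin.sum_univ_castSucc, level_castSucc, level_last, Finset.sum_sub_distrib]
  linarith

/-- The square `c²` cancels in the differences and survives only in the last level. -/
theorem level_sqDev (s : Fin (L + 1) → Θ → ℝ) (c : ℝ) (ℓ : Fin (L + 1)) (y : Θ) :
    level (sqDev s c) ℓ y = level (s ^ 2) ℓ y - 2 * c * level s ℓ y
      + if ℓ = Fin.last L then c ^ 2 else 0 := by
  cases ℓ using Fin.lastCases with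
  | last => simp [level_last, sqDev]; ring
  | cast i =>
    simp only [level_castSucc, sqDev, Pi.pow_apply, Fin.castSucc_ne_last, if_false]
    ring

theorem mcMean_add (M : ℕ) (x : ℕ → Θ) (f g : Θ → ℝ) :
    mcMean M x (fun y => f y + g y) = mcMean M x f + mcMean M x g := by
  simp only [mcMean, Finset.sum_add_distrib]; ring

theorem mcMean_sub (M : ℕ) (x : ℕ → Θ) (f g : Θ → ℝ) :
    mcMean M x (fun y => f y - g y) = mcMean M x f - mcMean M x g := by
  simp only [mcMean, Finset.sum_sub_distrib]; ring

theorem mcMean_const_mul (M : ℕ) (x : ℕ → Θ) (c : ℝ) (f : Θ → ℝ) :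
    mcMean M x (fun y => c * f y) = c * mcMean M x f := by
  simp only [mcMean, ← Finset.mul_sum]; ring

theorem mcMean_const {M : ℕ} (hM : 0 < M) (x : ℕ → Θ) (c : ℝ) :
    mcMean M x (fun _ => c) = c := by
  have : (M : ℝ) ≠ 0 := by positivity
  simp [mcMean, this]

theorem mcMean_apply_const {M : ℕ} (hM : 0 < M) (t : Θ) (f : Θ → ℝ) :
    mcMean M (fun _ => t) f = f t := by
  have : (M : ℝ) ≠ 0 := by positivity
  simp [mcMean, this]

theorem mcVar_apply_const {M : ℕ} (hM : 0 < M) (t : Θ) (f : Θ → ℝ) :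
    mcVar M (fun _ => t) f = 0 := by
  simp [mcVar, mcMean_apply_const hM]

theorem mcVar_add_const (M : ℕ) (x : ℕ → Θ) (f : Θ → ℝ) (c : ℝ) :
    mcVar M x (fun y => f y + c) = mcVar M x f := by
  rcases Nat.eq_zero_or_pos M with rfl | hM
  · simp [mcVar]
  · simp only [mcVar, mcMean_add, mcMean_const hM, add_sub_add_right_eq_sub]

theorem mcVar_nonneg (M : ℕ) (x : ℕ → Θ) (f : Θ → ℝ) : 0 ≤ mcVar M x f := by
  -- for `M = 0` the denominator is negative, but the sum is empty
  rcases Nat.eq_zero_or_pos M with rfl | hM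
  · simp [mcVar]
  · have : (1 : ℝ) ≤ M := by exact_mod_cast hM
    exact div_nonneg (Finset.sum_nonneg fun _ _ => sq_nonneg _) (by linarith)

/-- The identity also holds for `M = 0` and `M = 1`, where both sides are `0`. -/
theorem mcVar_eq (M : ℕ) (x : ℕ → Θ) (f : Θ → ℝ) :
    mcVar M x f = (mcMean M x (f ^ 2) - mcMean M x f ^ 2) * (M / ((M : ℝ) - 1)) := by
  rcases Nat.eq_zero_or_pos M with rfl | hM
  · simp [mcVar]
  have h0 : (M : ℝ) ≠ 0 := by positivity
  have h1 : ∑ m ∈ Finset.range M, f (x m) = M * mcMean M x f := by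
    rw [mcMean]; field_simp
  have h2 : ∑ m ∈ Finset.range M, f (x m) ^ 2 = M * mcMean M x (f ^ 2) := by
    simp only [mcMean, Pi.pow_apply]; field_simp
  have h3 : ∑ m ∈ Finset.range M, (mcMean M x f - f (x m)) ^ 2
      = M * (mcMean M x (f ^ 2) - mcMean M x f ^ 2) := by
    simp only [sub_sq, Finset.sum_add_distrib, Finset.sum_sub_distrib, ← Finset.mul_sum, h1, h2,
      Finset.sum_const, Finset.card_range, nsmul_eq_mul]
    ring
  rw [mcVar, h3]; ring

theorem mcVar_level_sqDev (M : ℕ) (x : ℕ → Θ) (s : Fin (L + 1) → Θ → ℝ) (c : ℝ)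
    (ℓ : Fin (L + 1)) :
    mcVar M x (level (sqDev s c) ℓ)
      = mcVar M x (fun y => level (s ^ 2) ℓ y - 2 * c * level s ℓ y) := by
  rw [← mcVar_add_const M x (fun y => level (s ^ 2) ℓ y - 2 * c * level s ℓ y)
    (if ℓ = Fin.last L then c ^ 2 else 0)]
  exact congrArg _ (funext fun y => level_sqDev s c ℓ y)


theorem level_mem {𝒜 : Subalgebra ℝ (Θ → ℝ)} {f : Fin (L + 1) → Θ → ℝ} (hf : ∀ ℓ, f ℓ ∈ 𝒜)
    (ℓ : Fin (L + 1)) : level f ℓ ∈ 𝒜 := by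
  cases ℓ using Fin.lastCases with
  | last => rw [show level f (Fin.last L) = _ from funext (level_last f)]; exact hf _
  | cast i =>
    rw [show level f i.castSucc = _ from funext (level_castSucc f i)]
    exact sub_mem (hf _) (hf _)

theorem continuous_mcVar_sub_mul (M : ℕ) (x : ℕ → Θ) (f g : Θ → ℝ) :
    Continuous fun c : ℝ => mcVar M x (fun y => g y - 2 * c * f y) := by
  simp only [mcVar, mcMean]
  fun_prop

end Level

/-! ### Estimates with some levels averaged exactly -/

section Hybrid

variable {Θ : Type*} [MeasurableSpace Θ] {L : ℕ}

/-- The sample mean of `h` on the levels below `k`, and the exact mean on the other levels: what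
the level-`ℓ` mean becomes once the limits in `M_k, …, M_L` have been taken. -/
def levelMean (μ : Measure Θ) (k : ℕ) (M : Fin (L + 1) → ℕ) (x : Fin (L + 1) → ℕ → Θ)
    (ℓ : Fin (L + 1)) (h : Θ → ℝ) : ℝ :=
  if (ℓ : ℕ) < k then mcMean (M ℓ) (x ℓ) h else ∫ y, h y ∂μ

/-- The multilevel mean with exact means on the levels from `k` on. -/
def hybridMean (μ : Measure Θ) (k : ℕ) (M : Fin (L + 1) → ℕ) (x : Fin (L + 1) → ℕ → Θ)
    (f : Fin (L + 1) → Θ → ℝ) : ℝ :=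
  ∑ ℓ, levelMean μ k M x ℓ (level f ℓ)

/-- The error of the multilevel variance estimate with exact means on the levels from `k` on. The
estimate is written as `E[s²] - (E[s])²` with multilevel means `E`, see `hybridMean_sqDev`. -/
def hybridDefect (μ : Measure Θ) (s : Fin (L + 1) → Θ → ℝ) (k : ℕ) (M : Fin (L + 1) → ℕ)
    (x : Fin (L + 1) → ℕ → Θ) : ℝ :=
  variance (s 0) μ - (hybridMean μ k M x (s ^ 2) - hybridMean μ k M x s ^ 2)

/-- The sum under the root in the error bound, restricted to the levels below `k`; the other terms
vanish in the limit. -/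
def hybridSpread (μ : Measure Θ) (s : Fin (L + 1) → Θ → ℝ) (k : ℕ) (M : Fin (L + 1) → ℕ)
    (x : Fin (L + 1) → ℕ → Θ) : ℝ :=
  ∑ ℓ : Fin (L + 1), if (ℓ : ℕ) < k then
    mcVar (M ℓ) (x ℓ) (level (sqDev s (hybridMean μ k M x s)) ℓ) / M ℓ else 0

/-- The event under study, once the limits in `M_k, …, M_L` have been taken, is `hybridGap ≤ 0`. In
contrast to the absolute error and the bound, the gap is a polynomial in the sampled outputs. -/
def hybridGap (μ : Measure Θ) (s : Fin (L + 1) → Θ → ℝ) (a : ℝ) (k : ℕ) (M : Fin (L + 1) → ℕ)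
    (x : Fin (L + 1) → ℕ → Θ) : ℝ :=
  hybridDefect μ s k M x ^ 2 - a ^ 2 * hybridSpread μ s k M x

variable {μ : Measure Θ} {s : Fin (L + 1) → Θ → ℝ}

theorem hybridMean_full (M : Fin (L + 1) → ℕ) (x : Fin (L + 1) → ℕ → Θ)
    (f : Fin (L + 1) → Θ → ℝ) : hybridMean μ (L + 1) M x f = mlMean M x f :=
  Finset.sum_congr rfl fun ℓ _ => if_pos ℓ.isLt

theorem tendsto_hybridMean {M : Fin (L + 1) → ℕ} {x : Fin (L + 1) → ℕ → Θ} (k : Fin (L + 1))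
    {f : Fin (L + 1) → Θ → ℝ}
    (hf : Tendsto (fun m => mcMean m (x k) (level f k)) atTop (𝓝 (∫ y, level f k y ∂μ))) :
    Tendsto (fun m => hybridMean μ (k + 1) (Function.update M k m) x f) atTop
      (𝓝 (hybridMean μ k M x f)) := by
  refine tendsto_finsetSum _ fun ℓ _ => ?_
  simp only [levelMean]
  rcases lt_trichotomy ℓ k with h | rfl | h
  · simp [Nat.lt_succ_of_lt (Fin.lt_def.1 h), h, h.ne]
  · simpa using hf
  · have h1 : ¬(ℓ : ℕ) < k + 1 := by have := Fin.lt_def.1 h; omega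
    simp [h1, h.le]

/-- The first and second empirical moments of the pair `(f, g)` along `x` converge to the moments
under `μ`. -/
structure MomentsConverge (μ : Measure Θ) (x : ℕ → Θ) (f g : Θ → ℝ) : Prop where
  fst : Tendsto (fun m => mcMean m x f) atTop (𝓝 (∫ y, f y ∂μ))
  snd : Tendsto (fun m => mcMean m x g) atTop (𝓝 (∫ y, g y ∂μ))
  fst_fst : Tendsto (fun m => mcMean m x (f * f)) atTop (𝓝 (∫ y, (f * f) y ∂μ))
  fst_snd : Tendsto (fun m => mcMean m x (f * g)) atTop (𝓝 (∫ y, (f * g) y ∂μ))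
  snd_snd : Tendsto (fun m => mcMean m x (g * g)) atTop (𝓝 (∫ y, (g * g) y ∂μ))

/-- The sample variance of `g - 2 c f` converges even when `c` itself varies with the sample size,
as the multilevel estimate of the mean does. -/
theorem tendsto_mcVar_sub_mul [IsProbabilityMeasure μ] {x : ℕ → Θ} {f g : Θ → ℝ}
    (hf : Integrable f μ) (hg : Integrable g μ) (hff : Integrable (f * f) μ)
    (hfg : Integrable (f * g) μ) (hgg : Integrable (g * g) μ)
    (hx : MomentsConverge μ x f g)
    {c : ℕ → ℝ} {c₀ : ℝ} (hc : Tendsto c atTop (𝓝 c₀)) :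
    Tendsto (fun m => mcVar m x (fun y => g y - 2 * c m * f y)) atTop
      (𝓝 (variance (fun y => g y - 2 * c₀ * f y) μ)) := by
  have hM : Tendsto (fun m : ℕ => (m : ℝ) / ((m : ℝ) - 1)) atTop (𝓝 1) := by
    simpa [sub_eq_add_neg] using tendsto_natCast_div_add_atTop (-1 : ℝ)
  have hexp : ∀ c : ℝ, (fun y => g y - 2 * c * f y) ^ 2
      = fun y => ((g * g) y - 4 * c * (f * g) y) + 4 * c ^ 2 * (f * f) y := fun c => by
    funext y; simp only [Pi.pow_apply, Pi.mul_apply]; ring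
  have hvar : variance (fun y => g y - 2 * c₀ * f y) μ
      = ((∫ y, (g * g) y ∂μ) - 4 * c₀ * (∫ y, (f * g) y ∂μ) + 4 * c₀ ^ 2 * (∫ y, (f * f) y ∂μ)
        - ((∫ y, g y ∂μ) - 2 * c₀ * ∫ y, f y ∂μ) ^ 2) * 1 := by
    have hmem : MemLp (fun y => g y - 2 * c₀ * f y) 2 μ := by
      refine (memLp_two_iff_integrable_sq (hg.sub (hf.const_mul _)).aestronglyMeasurable).2 ?_
      change Integrable ((fun y => g y - 2 * c₀ * f y) ^ 2) μ
      rw [hexp]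
      exact (hgg.sub (hfg.const_mul _)).add (hff.const_mul _)
    have e : Integrable (fun y => (g * g) y - 4 * c₀ * (f * g) y) μ := hgg.sub (hfg.const_mul _)
    rw [variance_eq_sub hmem, hexp, integral_add e (hff.const_mul _),
      integral_sub hgg (hfg.const_mul _), integral_sub hg (hf.const_mul _)]
    simp only [integral_const_mul, mul_one]
  rw [hvar]
  simp only [mcVar_eq, hexp, mcMean_add, mcMean_sub, mcMean_const_mul]
  exact (((hx.snd_snd.sub ((hc.const_mul 4).mul hx.fst_snd)).add
    (((hc.pow 2).const_mul 4).mul hx.fst_fst)).sub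
    ((hx.snd.sub ((hc.const_mul 2).mul hx.fst)).pow 2)).mul hM


/-- An algebra of measurable and integrable functions in which a function that is nonzero at one
point of `B`, a set of full measure, is nonzero almost everywhere. Rational functions without poles
on the parameter box form such an algebra. -/
structure IsRegularAlgebra (𝒜 : Subalgebra ℝ (Θ → ℝ)) (μ : Measure Θ) (B : Set Θ) : Prop where
  measurable : ∀ f ∈ 𝒜, Measurable f
  integrable : ∀ f ∈ 𝒜, Integrable f μ
  ae_mem : ∀ᵐ y ∂μ, y ∈ B
  ae_ne_zero : ∀ f ∈ 𝒜, (∃ y ∈ B, f y ≠ 0) → ∀ᵐ y ∂μ, f y ≠ 0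

variable {𝒜 : Subalgebra ℝ (Θ → ℝ)} {B : Set Θ}

theorem IsRegularAlgebra.memLp_two (h𝒜 : IsRegularAlgebra 𝒜 μ B) {f : Θ → ℝ} (hf : f ∈ 𝒜) :
    MemLp f 2 μ :=
  (memLp_two_iff_integrable_sq (h𝒜.measurable f hf).aestronglyMeasurable).2
    (h𝒜.integrable _ (pow_mem hf 2))

/-- The limit `M_k → ∞` replaces the sample means on level `k` by exact means. -/
theorem tendsto_hybridGap [IsProbabilityMeasure μ] (h𝒜 : IsRegularAlgebra 𝒜 μ B)
    (hs : ∀ ℓ, s ℓ ∈ 𝒜) (a : ℝ) {M : Fin (L + 1) → ℕ} {x : Fin (L + 1) → ℕ → Θ} (k : Fin (L + 1))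
    (hx : MomentsConverge μ (x k) (level s k) (level (s ^ 2) k)) :
    Tendsto (fun m => hybridGap μ s a (k + 1) (Function.update M k m) x) atTop
      (𝓝 (hybridGap μ s a k M x)) := by
  have hf : level s k ∈ 𝒜 := level_mem hs k
  have hg : level (s ^ 2) k ∈ 𝒜 := level_mem (fun ℓ => pow_mem (hs ℓ) 2) k
  have hc := tendsto_hybridMean (μ := μ) (M := M) k hx.fst
  have hc2 := tendsto_hybridMean (μ := μ) (M := M) k hx.snd
  refine ((((hc2.sub (hc.pow 2))).const_sub _).pow 2).sub (Tendsto.const_mul _ ?_)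
  refine tendsto_finsetSum _ fun ℓ _ => ?_
  simp only [mcVar_level_sqDev]
  rcases lt_trichotomy ℓ k with h | rfl | h
  · simp only [Nat.lt_succ_of_lt (Fin.lt_def.1 h), Fin.lt_def.1 h, if_true, ne_eq, h.ne,
      not_false_eq_true, Function.update_of_ne]
    exact (((continuous_mcVar_sub_mul _ _ _ _).tendsto _).comp hc).div_const _
  · simp only [Nat.lt_succ_self, if_true, Function.update_self, lt_irrefl, if_false]
    exact (tendsto_mcVar_sub_mul (h𝒜.integrable _ hf) (h𝒜.integrable _ hg)
      (h𝒜.integrable _ (mul_mem hf hf)) (h𝒜.integrable _ (mul_mem hf hg))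
      (h𝒜.integrable _ (mul_mem hg hg)) hx hc).div_atTop tendsto_natCast_atTop_atTop
  · have h1 : ¬(ℓ : ℕ) < k + 1 := by have := Fin.lt_def.1 h; omega
    have h2 : ¬(ℓ : ℕ) < k := by omega
    simp [h1, h.le]

/-- As the level quantities telescope, the squared deviations from `c` have the multilevel mean
that expanding the square suggests. -/
theorem hybridMean_sqDev [IsProbabilityMeasure μ] (h𝒜 : IsRegularAlgebra 𝒜 μ B)
    (hs : ∀ ℓ, s ℓ ∈ 𝒜) {k : ℕ} {M : Fin (L + 1) → ℕ} (hM : ∀ ℓ, 0 < M ℓ)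
    (x : Fin (L + 1) → ℕ → Θ) (c : ℝ) :
    hybridMean μ k M x (sqDev s c)
      = hybridMean μ k M x (s ^ 2) - 2 * c * hybridMean μ k M x s + c ^ 2 := by
  have key : ∀ ℓ, levelMean μ k M x ℓ (level (sqDev s c) ℓ)
      = levelMean μ k M x ℓ (level (s ^ 2) ℓ) - 2 * c * levelMean μ k M x ℓ (level s ℓ)
        + if ℓ = Fin.last L then c ^ 2 else 0 := fun ℓ => by
    have hf := h𝒜.integrable _ (level_mem hs ℓ)
    have hg := h𝒜.integrable _ (level_mem (f := s ^ 2) (fun ℓ => pow_mem (hs ℓ) 2) ℓ)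
    have e : Integrable (fun y => level (s ^ 2) ℓ y - 2 * c * level s ℓ y) μ :=
      hg.sub (hf.const_mul _)
    rw [show level (sqDev s c) ℓ = _ from funext (level_sqDev s c ℓ)]
    simp only [levelMean]
    split_ifs
    · rw [mcMean_add, mcMean_sub, mcMean_const_mul, mcMean_const (hM ℓ)]
    · rw [mcMean_add, mcMean_sub, mcMean_const_mul, mcMean_const (hM ℓ)]
    · rw [integral_add e (integrable_const _), integral_sub hg (hf.const_mul _),
        integral_const_mul]
      simp
    · rw [integral_add e (integrable_const _), integral_sub hg (hf.const_mul _),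
        integral_const_mul]
      simp
  simp only [hybridMean, key, Finset.sum_add_distrib, Finset.sum_sub_distrib, ← Finset.mul_sum,
    Finset.sum_ite_eq', Finset.mem_univ, if_true]

theorem abs_sub_mlVar_le_varBound_iff [IsProbabilityMeasure μ]
    (h𝒜 : IsRegularAlgebra 𝒜 μ B) (hs : ∀ ℓ, s ℓ ∈ 𝒜) {a : ℝ} (ha : 0 < a) (M : Fin (L + 1) → ℕ)
    (hM : ∀ ℓ, 0 < M ℓ) (x : Fin (L + 1) → ℕ → Θ) :
    |variance (s 0) μ - mlVar M x s| ≤ varBound a M x s ↔ hybridGap μ s a (L + 1) M x ≤ 0 := by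
  have hS : 0 ≤ ∑ ℓ, mcVar (M ℓ) (x ℓ) (level (sqDev s (mlMean M x s)) ℓ) / M ℓ :=
    Finset.sum_nonneg fun ℓ _ => div_nonneg (mcVar_nonneg _ _ _) (Nat.cast_nonneg _)
  have h1 : hybridDefect μ s (L + 1) M x = variance (s 0) μ - mlVar M x s := by
    rw [hybridDefect, mlVar, ← hybridMean_full (μ := μ), ← hybridMean_full (μ := μ),
      hybridMean_sqDev h𝒜 hs (k := L + 1) hM]
    ring
  have h2 : hybridSpread μ s (L + 1) M x
      = ∑ ℓ, mcVar (M ℓ) (x ℓ) (level (sqDev s (mlMean M x s)) ℓ) / M ℓ := by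
    simp only [hybridSpread, hybridMean_full, Fin.is_lt, if_true]
  rw [hybridGap, h1, h2, varBound, sub_nonpos, ← sq_le_sq₀ (abs_nonneg _) (by positivity), sq_abs,
    mul_pow, Real.sq_sqrt hS]

end Hybrid

/-! ### Algebraic dependence on the samples -/

section Membership

variable {T Θ : Type*} {L : ℕ} {𝒟 : Subalgebra ℝ (T → ℝ)}

theorem mcMean_mem (M : ℕ) {x : T → ℕ → Θ} {h : T → Θ → ℝ}
    (hx : ∀ m, (fun t => h t (x t m)) ∈ 𝒟) : (fun t => mcMean M (x t) (h t)) ∈ 𝒟 := by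
  have : (fun t => mcMean M (x t) (h t))
      = (M : ℝ)⁻¹ • ∑ m ∈ Finset.range M, fun t => h t (x t m) := by
    funext t; simp [mcMean]; ring
  rw [this]
  exact 𝒟.smul_mem (sum_mem fun m _ => hx m) _

theorem mcVar_mem (M : ℕ) {x : T → ℕ → Θ} {h : T → Θ → ℝ}
    (hx : ∀ m, (fun t => h t (x t m)) ∈ 𝒟) : (fun t => mcVar M (x t) (h t)) ∈ 𝒟 := by
  have : (fun t => mcVar M (x t) (h t)) = ((M : ℝ) - 1)⁻¹ • ∑ m ∈ Finset.range M,
      ((fun t => mcMean M (x t) (h t)) - fun t => h t (x t m)) ^ 2 := by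
    funext t; simp [mcVar]; ring
  rw [this]
  exact 𝒟.smul_mem (sum_mem fun m _ => pow_mem (sub_mem (mcMean_mem M hx) (hx m)) 2) _

theorem const_mem (c : ℝ) : (fun _ : T => c) ∈ 𝒟 := 𝒟.algebraMap_mem c

theorem level_comp_mem {f : Fin (L + 1) → Θ → ℝ} {x : T → Θ}
    (hx : ∀ j, (fun t => f j (x t)) ∈ 𝒟) (ℓ : Fin (L + 1)) :
    (fun t => level f ℓ (x t)) ∈ 𝒟 := by
  cases ℓ using Fin.lastCases with
  | last => simpa only [level_last] using hx _
  | cast i =>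
    simp only [level_castSucc]
    exact sub_mem (hx i.castSucc) (hx i.succ)

variable [MeasurableSpace Θ] {μ : Measure Θ} {s : Fin (L + 1) → Θ → ℝ}
  {X : T → Fin (L + 1) → ℕ → Θ}

theorem hybridMean_mem (k : ℕ) (M : Fin (L + 1) → ℕ) {f : Fin (L + 1) → Θ → ℝ}
    (hX : ∀ ℓ m j, (fun t => f j (X t ℓ m)) ∈ 𝒟) :
    (fun t => hybridMean μ k M (X t) f) ∈ 𝒟 := by
  have : (fun t => hybridMean μ k M (X t) f)
      = ∑ ℓ, fun t => levelMean μ k M (X t) ℓ (level f ℓ) := by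
    funext t; simp [hybridMean]
  rw [this]
  refine sum_mem fun ℓ _ => ?_
  simp only [levelMean]
  split_ifs
  · exact mcMean_mem _ fun m => level_comp_mem (hX ℓ m) ℓ
  · exact const_mem _

/-- Any algebra that contains the sampled outputs, as functions of a parameter `t` on which the
samples depend, contains the gap. This gives both measurability and the regularity of the
one-variable sections. -/
theorem hybridGap_mem (a : ℝ) (k : ℕ) (M : Fin (L + 1) → ℕ)
    (hX : ∀ ℓ m j, (fun t => s j (X t ℓ m)) ∈ 𝒟) :
    (fun t => hybridGap μ s a k M (X t)) ∈ 𝒟 := by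
  have hX2 : ∀ ℓ m j, (fun t => (s ^ 2) j (X t ℓ m)) ∈ 𝒟 := fun ℓ m j => pow_mem (hX ℓ m j) 2
  have hc : (fun t => hybridMean μ k M (X t) s) ∈ 𝒟 := hybridMean_mem k M hX
  have hS : (fun t => hybridSpread μ s k M (X t)) ∈ 𝒟 := by
    have : (fun t => hybridSpread μ s k M (X t)) = ∑ ℓ : Fin (L + 1), fun t =>
        if (ℓ : ℕ) < k then
          mcVar (M ℓ) (X t ℓ) (level (sqDev s (hybridMean μ k M (X t) s)) ℓ) / M ℓ else 0 := by
      funext t; simp [hybridSpread]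
    rw [this]
    refine sum_mem fun ℓ _ => ?_
    split_ifs
    · simp only [mcVar_level_sqDev, div_eq_inv_mul]
      refine mul_mem (const_mem _) (mcVar_mem _ fun m => ?_)
      exact sub_mem (level_comp_mem (hX2 ℓ m) ℓ)
        (mul_mem (mul_mem (const_mem _) hc) (level_comp_mem (hX ℓ m) ℓ))
    · exact const_mem _
  exact sub_mem (pow_mem (sub_mem (const_mem _)
    (sub_mem (hybridMean_mem k M hX2) (pow_mem hc 2))) 2) (mul_mem (const_mem _) hS)

/-- The algebra of measurable real functions. -/
def measurableSubalgebra (T : Type*) [MeasurableSpace T] : Subalgebra ℝ (T → ℝ) where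
  carrier := {f | Measurable f}
  mul_mem' hf hg := Measurable.mul hf hg
  add_mem' hf hg := Measurable.add hf hg
  algebraMap_mem' _ := measurable_const

theorem measurable_hybridGap [MeasurableSpace T] (hs : ∀ j, Measurable (s j))
    (hX : ∀ ℓ m, Measurable fun t => X t ℓ m) (a : ℝ) (k : ℕ) (M : Fin (L + 1) → ℕ) :
    Measurable fun t => hybridGap μ s a k M (X t) :=
  hybridGap_mem (𝒟 := measurableSubalgebra T) a k M fun ℓ m j => (hs j).comp (hX ℓ m)

theorem hybridGap_congr (a : ℝ) (k : ℕ) {M M' : Fin (L + 1) → ℕ} {x x' : Fin (L + 1) → ℕ → Θ}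
    (hM : ∀ ℓ : Fin (L + 1), (ℓ : ℕ) < k → M ℓ = M' ℓ)
    (hx : ∀ ℓ : Fin (L + 1), (ℓ : ℕ) < k → ∀ m < M ℓ, x ℓ m = x' ℓ m) :
    hybridGap μ s a k M x = hybridGap μ s a k M' x' := by
  have hmean : ∀ ℓ : Fin (L + 1), (ℓ : ℕ) < k → ∀ h : Θ → ℝ,
      mcMean (M ℓ) (x ℓ) h = mcMean (M' ℓ) (x' ℓ) h := fun ℓ hℓ h => by
    rw [mcMean, mcMean, ← hM ℓ hℓ]
    exact congrArg (· / _) (Finset.sum_congr rfl fun m hm => by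
      rw [hx ℓ hℓ m (Finset.mem_range.1 hm)])
  have hmix : ∀ f, hybridMean μ k M x f = hybridMean μ k M' x' f := fun f => by
    refine Finset.sum_congr rfl fun ℓ _ => ?_
    simp only [levelMean]
    split_ifs with hℓ
    · exact hmean ℓ hℓ _
    · rfl
  have hS : hybridSpread μ s k M x = hybridSpread μ s k M' x' := by
    refine Finset.sum_congr rfl fun ℓ _ => ?_
    split_ifs with hℓ
    · rw [hmix, mcVar, mcVar, hmean ℓ hℓ, ← hM ℓ hℓ]
      refine congrArg (· / _) (congrArg (· / _) (Finset.sum_congr rfl fun m hm => by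
        rw [hx ℓ hℓ m (Finset.mem_range.1 hm)]))
    · rfl
  rw [hybridGap, hybridGap, hybridDefect, hybridDefect, hS, hmix, hmix]

end Membership

/-! ### Passing to the limit in an inner level -/

section Samples

variable {Ω Θ : Type*} [MeasurableSpace Ω] [MeasurableSpace Θ] {L : ℕ}

/-- The `Y ℓ m` are independent samples with law `μ`. -/
structure IsSampleArray (P : Measure Ω) (μ : Measure Θ) (Y : Fin (L + 1) → ℕ → Ω → Θ) : Prop where
  measurable : ∀ ℓ m, Measurable (Y ℓ m)
  map_eq : ∀ ℓ m, P.map (Y ℓ m) = μ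
  indep : iIndepFun (fun i : Fin (L + 1) × ℕ => Y i.1 i.2) P

variable {P : Measure Ω} {μ : Measure Θ} {Y : Fin (L + 1) → ℕ → Ω → Θ}
  {𝒜 : Subalgebra ℝ (Θ → ℝ)} {B : Set Θ} {s : Fin (L + 1) → Θ → ℝ}

namespace IsSampleArray

theorem measurePreserving (hY : IsSampleArray P μ Y) (ℓ : Fin (L + 1)) (m : ℕ) :
    MeasurePreserving (Y ℓ m) P μ :=
  ⟨hY.measurable ℓ m, hY.map_eq ℓ m⟩

theorem integral_comp (hY : IsSampleArray P μ Y) (ℓ : Fin (L + 1)) (m : ℕ) {f : Θ → ℝ}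
    (hf : Measurable f) : ∫ ω, f (Y ℓ m ω) ∂P = ∫ y, f y ∂μ := by
  rw [← hY.map_eq ℓ m, integral_map (hY.measurable ℓ m).aemeasurable hf.aestronglyMeasurable]

theorem variance_comp (hY : IsSampleArray P μ Y) (ℓ : Fin (L + 1)) (m : ℕ) {f : Θ → ℝ}
    (hf : Measurable f) : variance (fun ω => f (Y ℓ m ω)) P = variance f μ := by
  rw [← hY.map_eq ℓ m, variance_map hf.aemeasurable (hY.measurable ℓ m).aemeasurable]
  rfl

theorem iIndepFun_comp (hY : IsSampleArray P μ Y) (ℓ : Fin (L + 1)) {f : Θ → ℝ}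
    (hf : Measurable f) : iIndepFun (fun m ω => f (Y ℓ m ω)) P := by
  have h := hY.indep.precomp (g := fun m : ℕ => (ℓ, m)) fun m m' h => (Prod.ext_iff.1 h).2
  exact h.comp (fun _ => f) fun _ => hf

theorem identDistrib_comp (hY : IsSampleArray P μ Y) (ℓ : Fin (L + 1)) {f : Θ → ℝ}
    (hf : Measurable f) (m : ℕ) :
    IdentDistrib (fun ω => f (Y ℓ m ω)) (fun ω => f (Y ℓ 0 ω)) P P := by
  have : IdentDistrib (Y ℓ m) (Y ℓ 0) P P :=
    ⟨(hY.measurable ℓ m).aemeasurable, (hY.measurable ℓ 0).aemeasurable,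
      (hY.map_eq ℓ m).trans (hY.map_eq ℓ 0).symm⟩
  exact this.comp hf


theorem ae_tendsto_mcMean (hY : IsSampleArray P μ Y) (h𝒜 : IsRegularAlgebra 𝒜 μ B)
    (ℓ : Fin (L + 1)) {f : Θ → ℝ} (hf : f ∈ 𝒜) :
    ∀ᵐ ω ∂P, Tendsto (fun M => mcMean M (fun m => Y ℓ m ω) f) atTop (𝓝 (∫ y, f y ∂μ)) := by
  have hfm := h𝒜.measurable f hf
  have h := strong_law_ae_real (fun m ω => f (Y ℓ m ω))
    ((hY.measurePreserving ℓ 0).integrable_comp_of_integrable (h𝒜.integrable f hf))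
    (fun i j hij => (hY.iIndepFun_comp ℓ hfm).indepFun hij) (hY.identDistrib_comp ℓ hfm)
  rwa [hY.integral_comp ℓ 0 hfm] at h

theorem ae_momentsConverge (hY : IsSampleArray P μ Y) (h𝒜 : IsRegularAlgebra 𝒜 μ B)
    (ℓ : Fin (L + 1)) {f g : Θ → ℝ} (hf : f ∈ 𝒜) (hg : g ∈ 𝒜) :
    ∀ᵐ ω ∂P, MomentsConverge μ (fun m => Y ℓ m ω) f g := by
  filter_upwards [hY.ae_tendsto_mcMean h𝒜 ℓ hf, hY.ae_tendsto_mcMean h𝒜 ℓ hg,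
    hY.ae_tendsto_mcMean h𝒜 ℓ (mul_mem hf hf), hY.ae_tendsto_mcMean h𝒜 ℓ (mul_mem hf hg),
    hY.ae_tendsto_mcMean h𝒜 ℓ (mul_mem hg hg)] with ω h1 h2 h3 h4 h5
  exact ⟨h1, h2, h3, h4, h5⟩

variable [IsProbabilityMeasure P]

/-- With all samples of a level equal, the hybrid mean is a sum of independent variables. -/
theorem moments_hybridMean_diag [IsProbabilityMeasure μ] (hY : IsSampleArray P μ Y)
    (h𝒜 : IsRegularAlgebra 𝒜 μ B) {M : Fin (L + 1) → ℕ} (hM : ∀ ℓ, 0 < M ℓ) (k : ℕ)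
    {f : Fin (L + 1) → Θ → ℝ} (hf : ∀ ℓ, f ℓ ∈ 𝒜) :
    MemLp (fun ω => hybridMean μ k M (fun ℓ _ => Y ℓ 0 ω) f) 2 P ∧
    ∫ ω, hybridMean μ k M (fun ℓ _ => Y ℓ 0 ω) f ∂P = ∫ y, f 0 y ∂μ ∧
    variance (fun ω => hybridMean μ k M (fun ℓ _ => Y ℓ 0 ω) f) P
      = ∑ ℓ : Fin (L + 1), if (ℓ : ℕ) < k then variance (level f ℓ) μ else 0 := by
  let φ : Fin (L + 1) → Θ → ℝ := fun ℓ =>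
    if (ℓ : ℕ) < k then level f ℓ else fun _ => ∫ y, level f ℓ y ∂μ
  have hφ : ∀ ℓ, φ ℓ ∈ 𝒜 := fun ℓ => by
    simp only [φ]; split_ifs
    · exact level_mem hf ℓ
    · exact const_mem _
  have hφm := fun ℓ => h𝒜.measurable _ (hφ ℓ)
  have hint : ∀ ℓ, ∫ y, φ ℓ y ∂μ = ∫ y, level f ℓ y ∂μ := fun ℓ => by
    simp only [φ]; split_ifs <;> simp
  have hvar : ∀ ℓ, variance (φ ℓ) μ = if (ℓ : ℕ) < k then variance (level f ℓ) μ else 0 :=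
    fun ℓ => by
      simp only [φ]; split_ifs
      · rfl
      · simp [variance_eq_integral aemeasurable_const]
  have hH : (fun ω => hybridMean μ k M (fun ℓ _ => Y ℓ 0 ω) f)
      = ∑ ℓ, fun ω => φ ℓ (Y ℓ 0 ω) := by
    funext ω
    simp only [hybridMean, levelMean, Finset.sum_apply, φ]
    refine Finset.sum_congr rfl fun ℓ _ => ?_
    split_ifs
    · exact mcMean_apply_const (hM ℓ) _ _
    · rfl
  have hmem : ∀ ℓ, MemLp (fun ω => φ ℓ (Y ℓ 0 ω)) 2 P := fun ℓ =>
    (h𝒜.memLp_two (hφ ℓ)).comp_measurePreserving (hY.measurePreserving ℓ 0)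
  have hind : iIndepFun (fun ℓ ω => φ ℓ (Y ℓ 0 ω)) P := by
    have h := hY.indep.precomp (g := fun ℓ : Fin (L + 1) => (ℓ, 0))
      fun m m' h => (Prod.ext_iff.1 h).1
    exact h.comp φ hφm
  refine ⟨hH ▸ memLp_finsetSum' _ fun ℓ _ => hmem ℓ, ?_, ?_⟩
  · simp only [fun ω => congrFun hH ω, Finset.sum_apply]
    rw [integral_finsetSum _ fun ℓ _ => (hmem ℓ).integrable (by norm_num)]
    simp only [fun ℓ => hY.integral_comp ℓ 0 (hφm ℓ), hint]
    rw [← integral_finsetSum _ fun ℓ _ => h𝒜.integrable _ (level_mem hf ℓ)]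
    simp only [sum_level]
  · rw [hH, IndepFun.variance_sum (fun ℓ _ => hmem ℓ) fun i _ j _ hij => hind.indepFun hij]
    simp only [fun ℓ => hY.variance_comp ℓ 0 (hφm ℓ), hvar]

/-- If the defect vanished whenever all samples of a level coincide, then its expectation, which is
the variance of the hybrid mean of `s`, would vanish. So this hybrid mean would be constant, hence
also that of the squared deviations, whose variance is at least that of its level-`0` term. -/
theorem exists_hybridDefect_ne_zero [IsProbabilityMeasure μ] (hY : IsSampleArray P μ Y)
    (h𝒜 : IsRegularAlgebra 𝒜 μ B) (hs : ∀ ℓ, s ℓ ∈ 𝒜)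
    (hvar : 0 < variance (level (sqDev s (∫ y, s 0 y ∂μ)) 0) μ)
    {M : Fin (L + 1) → ℕ} (hM : ∀ ℓ, 0 < M ℓ) {k : ℕ} (hk : 0 < k) :
    ∃ t : Fin (L + 1) → Θ, (∀ ℓ, t ℓ ∈ B) ∧ hybridDefect μ s k M (fun ℓ _ => t ℓ) ≠ 0 := by
  by_contra! hcon
  set c₀ := ∫ y, s 0 y ∂μ with hc₀
  have hB : ∀ᵐ ω ∂P, ∀ ℓ, Y ℓ 0 ω ∈ B := ae_all_iff.2 fun ℓ =>
    (hY.measurePreserving ℓ 0).quasiMeasurePreserving.ae h𝒜.ae_mem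
  let H : (Fin (L + 1) → Θ → ℝ) → Ω → ℝ := fun f ω => hybridMean μ k M (fun ℓ _ => Y ℓ 0 ω) f
  have hs2 : ∀ ℓ, (s ^ 2) ℓ ∈ 𝒜 := fun ℓ => pow_mem (hs ℓ) 2
  have hD : ∀ᵐ ω ∂P, variance (s 0) μ - (H (s ^ 2) ω - H s ω ^ 2) = 0 := by
    filter_upwards [hB] with ω hω using hcon (fun ℓ => Y ℓ 0 ω) hω
  obtain ⟨m1, i1, -⟩ := hY.moments_hybridMean_diag h𝒜 hM k hs
  obtain ⟨m2, i2, -⟩ := hY.moments_hybridMean_diag h𝒜 hM k hs2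
  obtain ⟨-, -, v3⟩ := hY.moments_hybridMean_diag h𝒜 hM k (f := sqDev s c₀)
    fun ℓ => pow_mem (sub_mem (hs ℓ) (const_mem c₀)) 2
  -- the expectation of the defect is the variance of the hybrid mean, which therefore vanishes
  have hv1 : variance (H s) P = 0 := by
    rw [variance_eq_sub m1]
    have h0 : ∫ ω, (variance (s 0) μ - (H (s ^ 2) ω - H s ω ^ 2)) ∂P = 0 := by
      rw [integral_congr_ae hD]; simp
    have hi2 : Integrable (H (s ^ 2)) P := m2.integrable (by norm_num)
    have hi1 : Integrable (fun ω => H s ω ^ 2) P := m1.integrable_sq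
    have hi : Integrable (fun ω => H (s ^ 2) ω - H s ω ^ 2) P := hi2.sub hi1
    rw [integral_sub (integrable_const _) hi, integral_sub hi2 hi1,
      variance_eq_sub (h𝒜.memLp_two (hs 0))] at h0
    simp only [integral_const, probReal_univ, one_smul, Pi.pow_apply] at h0 i2 ⊢
    change ∫ ω, H (s ^ 2) ω ∂P = _ at i2
    change ∫ ω, H s ω ∂P = _ at i1
    rw [i2] at h0
    rw [i1]
    linarith
  have hconst : ∀ᵐ ω ∂P, H s ω = c₀ := by
    have := ae_eq_integral_of_variance_eq_zero m1 hv1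
    filter_upwards [this] with ω hω
    exact hω.trans i1
  have hv3 : variance (H (sqDev s c₀)) P = 0 := by
    have : H (sqDev s c₀) =ᵐ[P] fun _ => variance (s 0) μ := by
      filter_upwards [hconst, hD] with ω h1 h2
      change hybridMean μ k M (fun ℓ _ => Y ℓ 0 ω) (sqDev s c₀) = _
      rw [hybridMean_sqDev h𝒜 hs hM]
      change H (s ^ 2) ω - 2 * c₀ * H s ω + c₀ ^ 2 = _
      rw [h1] at h2 ⊢
      linarith
    rw [variance_congr this]
    simp [variance_eq_integral aemeasurable_const]
  have hpos : 0 < variance (H (sqDev s c₀)) P := by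
    rw [v3]
    refine Finset.sum_pos' (fun ℓ _ => ?_) ⟨0, Finset.mem_univ _, by simpa [hk] using hvar⟩
    split_ifs
    · exact variance_nonneg _ _
    · rfl
  exact hpos.ne' hv3

/-- The gap has no atom at `0`. On samples that are constant in each level the sample variances
vanish, so that the gap is the square of the defect, which is nonzero for a suitable choice. -/
theorem ae_hybridGap_ne_zero [IsProbabilityMeasure μ] (hY : IsSampleArray P μ Y)
    (h𝒜 : IsRegularAlgebra 𝒜 μ B) (hs : ∀ ℓ, s ℓ ∈ 𝒜)
    (hvar : 0 < variance (level (sqDev s (∫ y, s 0 y ∂μ)) 0) μ) (a : ℝ)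
    {M : Fin (L + 1) → ℕ} (hM : ∀ ℓ, 0 < M ℓ) {k : ℕ} (hk : 0 < k) :
    ∀ᵐ ω ∂P, hybridGap μ s a k M (fun ℓ m => Y ℓ m ω) ≠ 0 := by
  classical
  obtain ⟨t, htB, ht⟩ := hY.exists_hybridDefect_ne_zero h𝒜 hs hvar hM hk
  refine ae_ne_zero_of_sections (ι := Fin (L + 1) × ℕ) (Y := fun i => Y i.1 i.2)
    (fun i => hY.measurable _ _) hY.indep (𝒜 := 𝒜) (B := B) const_mem ?_ (y₀ := fun i => t i.1)
    (fun i => htB _) (Finset.univ.biUnion fun ℓ => (Finset.range (M ℓ)).image fun m => (ℓ, m))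
    (fun y => hybridGap μ s a k M fun ℓ m => y (ℓ, m)) ?_ ?_ ?_ ?_
  · intro i f hf hne
    rw [hY.map_eq]
    exact h𝒜.ae_ne_zero f hf hne
  · exact measurable_hybridGap (fun j => h𝒜.measurable _ (hs j))
      (fun ℓ m => measurable_pi_apply _) a k M
  · intro y i
    refine hybridGap_mem a k M fun ℓ m j => ?_
    rcases eq_or_ne (ℓ, m) i with h | h
    · simpa [h] using hs j
    · simpa [Function.update_of_ne h] using const_mem _
  · intro y y' h
    refine hybridGap_congr a k (fun _ _ => rfl) fun ℓ _ m hm => h _ ?_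
    simp [hm]
  · have : hybridSpread μ s k M (fun ℓ _ => t ℓ) = 0 := by
      refine Finset.sum_eq_zero fun ℓ _ => ?_
      rw [mcVar_apply_const (hM ℓ)]
      simp
    simpa [hybridGap, this] using ht

/-- The limit in an inner level: the gap converges almost surely, to a limit that is almost surely
nonzero, so the probabilities that it is nonpositive converge. -/
theorem tendsto_measure_hybridGap_nonpos [IsProbabilityMeasure μ] (hY : IsSampleArray P μ Y)
    (h𝒜 : IsRegularAlgebra 𝒜 μ B) (hs : ∀ ℓ, s ℓ ∈ 𝒜)
    (hvar : 0 < variance (level (sqDev s (∫ y, s 0 y ∂μ)) 0) μ) (a : ℝ)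
    {M : Fin (L + 1) → ℕ} (hM : ∀ ℓ, 0 < M ℓ) {k : Fin (L + 1)} (hk : 0 < (k : ℕ)) :
    Tendsto (fun m => P.real {ω |
        hybridGap μ s a (k + 1) (Function.update M k m) (fun ℓ m => Y ℓ m ω) ≤ 0}) atTop
      (𝓝 (P.real {ω | hybridGap μ s a k M (fun ℓ m => Y ℓ m ω) ≤ 0})) := by
  have hmeas : ∀ k M, MeasurableSet {ω | hybridGap μ s a k M (fun ℓ m => Y ℓ m ω) ≤ 0} :=
    fun k M => measurableSet_le (measurable_hybridGap (fun j => h𝒜.measurable _ (hs j))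
      hY.measurable a k M) measurable_const
  refine (ENNReal.tendsto_toReal (measure_ne_top _ _)).comp ?_
  refine tendsto_measure_of_ae_tendsto_indicator_of_isFiniteMeasure _ (hmeas _ _)
    (fun m => hmeas _ _) ?_
  filter_upwards [hY.ae_hybridGap_ne_zero h𝒜 hs hvar a hM hk,
    hY.ae_momentsConverge h𝒜 k (level_mem hs k)
      (level_mem (f := s ^ 2) (fun ℓ => pow_mem (hs ℓ) 2) k)] with ω hne hmom
  have hlim := tendsto_hybridGap h𝒜 hs a (M := M) (x := fun ℓ m => Y ℓ m ω) k hmom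
  rcases lt_or_gt_of_ne hne with h | h
  · filter_upwards [hlim.eventually_lt_const h] with m hm
    exact iff_of_true hm.le h.le
  · filter_upwards [hlim.eventually_const_lt h] with m hm
    exact iff_of_false hm.not_ge h.not_ge

end IsSampleArray

end Samples

/-! ### The central limit theorem in the outermost level -/

theorem gaussianReal_real_Icc_eq_erf {v : ℝ≥0} (hv : v ≠ 0) {a : ℝ} (ha : 0 < a) :
    (gaussianReal 0 v).real (Set.Icc (-(a * Real.sqrt v)) (a * Real.sqrt v))
      = erf (a / Real.sqrt 2) := by
  have hv0 : (0 : ℝ) < v := by positivity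
  have hc : Real.sqrt (2 * v) ≠ 0 := by positivity
  have hb : a * Real.sqrt v / Real.sqrt (2 * v) = a / Real.sqrt 2 := by
    rw [Real.sqrt_mul zero_le_two]
    have : Real.sqrt (v : ℝ) ≠ 0 := by positivity
    field_simp
  have hpdf : ∀ x, gaussianPDFReal 0 v x
      = (Real.sqrt (2 * Real.pi * v))⁻¹ * Real.exp (-(x / Real.sqrt (2 * v)) ^ 2) := fun x => by
    simp only [gaussianPDFReal_def]
    rw [div_pow, Real.sq_sqrt (by positivity), sub_zero, neg_div]
  have hsym : ∀ b : ℝ, ∫ t in -b..b, Real.exp (-t ^ 2)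
      = 2 * ∫ t in (0 : ℝ)..b, Real.exp (-t ^ 2) := by
    intro b
    have hi : ∀ u w : ℝ, IntervalIntegrable (fun t : ℝ => Real.exp (-t ^ 2)) volume u w :=
      fun u w => (by fun_prop : Continuous fun t : ℝ => Real.exp (-t ^ 2)).intervalIntegrable _ _
    have hneg : ∫ t in -b..0, Real.exp (-t ^ 2) = ∫ t in (0 : ℝ)..b, Real.exp (-t ^ 2) := by
      rw [← neg_zero, ← intervalIntegral.integral_comp_neg, neg_zero]
      simp only [even_two.neg_pow]
    rw [← intervalIntegral.integral_add_adjacent_intervals (hi (-b) 0) (hi 0 b), hneg, two_mul]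
  have hle : -(a * Real.sqrt v) ≤ a * Real.sqrt v := by
    have : 0 ≤ a * Real.sqrt v := by positivity
    linarith
  rw [Measure.real, gaussianReal_apply_eq_integral _ hv,
    ENNReal.toReal_ofReal (integral_nonneg fun x => gaussianPDFReal_nonneg _ _ _),
    integral_Icc_eq_integral_Ioc, ← intervalIntegral.integral_of_le hle]
  simp only [hpdf]
  rw [intervalIntegral.integral_const_mul,
    intervalIntegral.integral_comp_div (fun t => Real.exp (-t ^ 2)) hc, neg_div, hb, hsym, erf,
    smul_eq_mul, show 2 * Real.pi * v = Real.pi * (2 * v) by ring, Real.sqrt_mul Real.pi_pos.le]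
  field_simp

/-- Slutsky's theorem and the portmanteau theorem, in the form needed: `(T - R)² ≤ a² S` becomes
`Z² ≤ a² v` for a Gaussian `Z` of variance `v`. -/
theorem tendsto_measure_sq_sub_nonpos {Ω : Type*} [MeasurableSpace Ω] {P : Measure Ω}
    [IsProbabilityMeasure P] {T R S : ℕ → Ω → ℝ} {v : ℝ≥0} (hv : v ≠ 0) {a : ℝ} (ha : 0 < a)
    (hT : TendstoInDistribution T atTop (id : ℝ → ℝ) (fun _ => P) (gaussianReal 0 v))
    (hR : TendstoInMeasure P R atTop fun _ => 0) (hS : TendstoInMeasure P S atTop fun _ => (v : ℝ))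
    (hTm : ∀ n, Measurable (T n)) (hRm : ∀ n, Measurable (R n)) (hSm : ∀ n, Measurable (S n)) :
    Tendsto (fun n => P.real {ω | (T n ω - R n ω) ^ 2 - a ^ 2 * S n ω ≤ 0}) atTop
      (𝓝 (erf (a / Real.sqrt 2))) := by
  have hTR : TendstoInDistribution (fun n ω => T n ω - R n ω) atTop (id : ℝ → ℝ) (fun _ => P)
      (gaussianReal 0 v) := by
    have := hT.continuous_comp_prodMk_of_tendstoInMeasure_const (g := fun p : ℝ × ℝ => p.1 - p.2)
      (by fun_prop) hR fun n => (hRm n).aemeasurable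
    simp only [id, sub_zero] at this
    exact this
  have hlim := hTR.continuous_comp_prodMk_of_tendstoInMeasure_const
    (g := fun p : ℝ × ℝ => p.1 ^ 2 - a ^ 2 * p.2) (by fun_prop) hS fun n => (hSm n).aemeasurable
  have hsq : a ^ 2 * (v : ℝ) = (a * Real.sqrt v) ^ 2 := by rw [mul_pow, Real.sq_sqrt v.coe_nonneg]
  have hgm : Measurable fun z : ℝ => z ^ 2 - a ^ 2 * (v : ℝ) := by fun_prop
  have hport := ProbabilityMeasure.tendsto_measure_of_null_frontier_of_tendsto' hlim.tendsto
    (E := Set.Iic 0) (by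
      have : NullSingletonClass (gaussianReal 0 v) := nullSingletonClass_gaussianReal hv
      simp only [ProbabilityMeasure.coe_mk, frontier_Iic, id]
      rw [Measure.map_apply hgm (measurableSet_singleton _)]
      refine Set.Finite.measure_zero (Set.Finite.subset
        (Set.toFinite {a * Real.sqrt v, -(a * Real.sqrt v)}) fun z hz => ?_) _
      have hz' : z ^ 2 - a ^ 2 * (v : ℝ) = 0 := hz
      exact sq_eq_sq_iff_eq_or_eq_neg.1 (hsq ▸ sub_eq_zero.1 hz'))
  simp only [ProbabilityMeasure.coe_mk, id] at hport
  have hpre : (fun z : ℝ => z ^ 2 - a ^ 2 * (v : ℝ)) ⁻¹' Set.Iic 0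
      = Set.Icc (-(a * Real.sqrt v)) (a * Real.sqrt v) := Set.ext fun z => by
    rw [Set.mem_preimage, Set.mem_Iic, sub_nonpos, Set.mem_Icc, ← abs_le, hsq,
      ← sq_le_sq₀ (abs_nonneg z) (by positivity), sq_abs]
  rw [Measure.map_apply hgm measurableSet_Iic, hpre] at hport
  rw [← gaussianReal_real_Icc_eq_erf hv ha]
  refine ((ENNReal.tendsto_toReal (measure_ne_top _ _)).comp hport).congr fun n => ?_
  simp only [Function.comp_apply]
  have hm : Measurable fun ω => (T n ω - R n ω) ^ 2 - a ^ 2 * S n ω :=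
    (((hTm n).sub (hRm n)).pow_const 2).sub ((hSm n).const_mul _)
  rw [Measure.map_apply hm measurableSet_Iic]
  rfl

section CentralLimit

variable {Ω Θ : Type*} [MeasurableSpace Ω] [MeasurableSpace Θ] {L : ℕ}
  {P : Measure Ω} [IsProbabilityMeasure P] {μ : Measure Θ} [IsProbabilityMeasure μ]
  {Y : Fin (L + 1) → ℕ → Ω → Θ} {𝒜 : Subalgebra ℝ (Θ → ℝ)} {B : Set Θ}
  {s : Fin (L + 1) → Θ → ℝ}

omit [IsProbabilityMeasure μ] in
theorem hybridMean_one (h𝒜 : IsRegularAlgebra 𝒜 μ B) {f : Fin (L + 1) → Θ → ℝ}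
    (hf : ∀ ℓ, f ℓ ∈ 𝒜) (M : Fin (L + 1) → ℕ) (x : Fin (L + 1) → ℕ → Θ) :
    hybridMean μ 1 M x f
      = mcMean (M 0) (x 0) (level f 0) - (∫ y, level f 0 y ∂μ) + ∫ y, f 0 y ∂μ := by
  have h : ∑ ℓ, ∫ y, level f ℓ y ∂μ = ∫ y, f 0 y ∂μ := by
    rw [← integral_finsetSum _ fun ℓ _ => h𝒜.integrable _ (level_mem hf ℓ)]
    simp only [sum_level]
  rw [← h, hybridMean, Fin.sum_univ_succ, Fin.sum_univ_succ]
  simp [levelMean]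
  ring

/-- With `e` the error of the sample mean of `f`, the defect is `e²` minus the error of the sample
mean of `h = g - 2 c₀ f`. Only the latter is of order `n^(-1/2)`. -/
theorem natCast_mul_hybridGap_one (h𝒜 : IsRegularAlgebra 𝒜 μ B) (hs : ∀ ℓ, s ℓ ∈ 𝒜) (a : ℝ)
    (M : Fin (L + 1) → ℕ) (x : Fin (L + 1) → ℕ → Θ) (n : ℕ) {c₀ : ℝ} (hc₀ : ∫ y, s 0 y ∂μ = c₀)
    {f g h : Θ → ℝ} (hf : f = level s 0) (hg : g = level (s ^ 2) 0)
    (hh : h = fun y => g y - 2 * c₀ * f y) :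
    n * hybridGap μ s a 1 (Function.update M 0 n) x
      = (Real.sqrt n * (mcMean n (x 0) h - ∫ y, h y ∂μ)
          - Real.sqrt n * (mcMean n (x 0) f - ∫ y, f y ∂μ) ^ 2) ^ 2
        - a ^ 2 * mcVar n (x 0)
          (fun y => g y - 2 * (mcMean n (x 0) f - (∫ y, f y ∂μ) + c₀) * f y) := by
  rcases Nat.eq_zero_or_pos n with rfl | hn
  · simp [mcVar]
  have hn0 : (0 : ℝ) < n := by positivity
  have hs2 : ∀ ℓ, (s ^ 2) ℓ ∈ 𝒜 := fun ℓ => pow_mem (hs ℓ) 2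
  have hmean : hybridMean μ 1 (Function.update M 0 n) x s
      = mcMean n (x 0) f - (∫ y, f y ∂μ) + c₀ := by
    rw [hybridMean_one h𝒜 hs, Function.update_self, hf, hc₀]
  have hspread : hybridSpread μ s 1 (Function.update M 0 n) x
      = mcVar n (x 0) (fun y => g y - 2 * (mcMean n (x 0) f - (∫ y, f y ∂μ) + c₀) * f y) / n := by
    rw [hybridSpread, hmean, Fin.sum_univ_succ]
    simp only [Fin.val_zero, zero_lt_one, if_true, Function.update_self, Fin.val_succ,
      Nat.lt_one_iff, Nat.succ_ne_zero, if_false, Finset.sum_const_zero, add_zero,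
      mcVar_level_sqDev, ← hf, ← hg]
  have hEh : ∫ y, h y ∂μ = (∫ y, g y ∂μ) - 2 * c₀ * ∫ y, f y ∂μ := by
    rw [hh, hf, hg, integral_sub (h𝒜.integrable _ (level_mem hs2 0))
      ((h𝒜.integrable _ (level_mem hs 0)).const_mul _), integral_const_mul]
  have hhmean : mcMean n (x 0) h = mcMean n (x 0) g - 2 * c₀ * mcMean n (x 0) f := by
    rw [hh, mcMean_sub, mcMean_const_mul]
  have hdefect : hybridDefect μ s 1 (Function.update M 0 n) x
      = -(mcMean n (x 0) h - ∫ y, h y ∂μ) + (mcMean n (x 0) f - ∫ y, f y ∂μ) ^ 2 := by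
    rw [hybridDefect, hmean, hybridMean_one h𝒜 hs2, Function.update_self, hhmean, hEh,
      variance_eq_sub (h𝒜.memLp_two (hs 0)), hc₀, ← hg]
    simp only [Pi.pow_apply]
    ring
  rw [hybridGap, hdefect, hspread, ← mul_sub, mul_pow, Real.sq_sqrt hn0.le]
  field_simp
  ring

namespace IsSampleArray

omit [IsProbabilityMeasure μ] in
/-- The squared error of a sample mean has expectation `Var f / n`, so it is negligible at the
scale `n^(-1/2)`. -/
theorem tendstoInMeasure_sqrt_mul_sq (hY : IsSampleArray P μ Y) (h𝒜 : IsRegularAlgebra 𝒜 μ B)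
    (ℓ : Fin (L + 1)) {f : Θ → ℝ} (hf : f ∈ 𝒜) :
    TendstoInMeasure P (fun (n : ℕ) ω => Real.sqrt n *
      (mcMean n (fun m => Y ℓ m ω) f - ∫ y, f y ∂μ) ^ 2) atTop 0 := by
  have hfm := h𝒜.measurable f hf
  have hmem : ∀ m, MemLp (fun ω => f (Y ℓ m ω)) 2 P := fun m =>
    (h𝒜.memLp_two hf).comp_measurePreserving (hY.measurePreserving ℓ m)
  have hmean : ∀ n : ℕ, (fun ω => mcMean n (fun m => Y ℓ m ω) f)
      = fun ω => (n : ℝ)⁻¹ * (∑ m ∈ Finset.range n, fun ω => f (Y ℓ m ω)) ω := fun n => by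
    funext ω; simp [mcMean]; ring
  have hmemM : ∀ n : ℕ, MemLp (fun ω => mcMean n (fun m => Y ℓ m ω) f) 2 P := fun n => by
    rw [hmean]
    exact (memLp_finsetSum' _ fun m _ => hmem m).const_mul _
  have hmeas : ∀ n : ℕ, AEStronglyMeasurable (fun ω => Real.sqrt n *
      (mcMean n (fun m => Y ℓ m ω) f - ∫ y, f y ∂μ) ^ 2) P := fun n =>
    (((hmemM n).aestronglyMeasurable.sub aestronglyMeasurable_const).pow 2).const_mul _
  refine tendstoInMeasure_of_tendsto_eLpNorm one_ne_zero hmeas aestronglyMeasurable_zero ?_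
  have hint : ∀ n : ℕ, 0 < n → ∫ ω, (mcMean n (fun m => Y ℓ m ω) f - ∫ y, f y ∂μ) ^ 2 ∂P
      = variance f μ / n := fun n hn => by
    have hn0 : (n : ℝ) ≠ 0 := by positivity
    have hE : ∫ ω, mcMean n (fun m => Y ℓ m ω) f ∂P = ∫ y, f y ∂μ := by
      simp only [mcMean, integral_div]
      rw [integral_finsetSum _ fun m _ => (hmem m).integrable (by norm_num)]
      simp only [fun m => hY.integral_comp ℓ m hfm, Finset.sum_const, Finset.card_range,
        nsmul_eq_mul]
      field_simp
    rw [← hE, ← variance_eq_integral (hmemM n).aestronglyMeasurable.aemeasurable, hmean,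
      variance_const_mul, IndepFun.variance_sum (fun m _ => hmem m)
        fun i _ j _ hij => (hY.iIndepFun_comp ℓ hfm).indepFun hij]
    simp only [fun m => hY.variance_comp ℓ m hfm, Finset.sum_const, Finset.card_range,
        nsmul_eq_mul]
    field_simp
  have hnorm : ∀ᶠ n : ℕ in atTop, ENNReal.ofReal (variance f μ / Real.sqrt n)
      = eLpNorm ((fun ω => Real.sqrt n *
        (mcMean n (fun m => Y ℓ m ω) f - ∫ y, f y ∂μ) ^ 2) - 0) 1 P := by
    filter_upwards [eventually_gt_atTop 0] with n hn
    have hn0 : (0 : ℝ) < n := by positivity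
    have hi : Integrable (fun ω => Real.sqrt n *
        (mcMean n (fun m => Y ℓ m ω) f - ∫ y, f y ∂μ) ^ 2) P :=
      (((hmemM n).sub (memLp_const _)).integrable_sq).const_mul _
    rw [sub_zero, eLpNorm_one_eq_lintegral_enorm, ← ofReal_integral_norm_eq_lintegral_enorm hi]
    congr 1
    have : ∀ ω, ‖Real.sqrt n * (mcMean n (fun m => Y ℓ m ω) f - ∫ y, f y ∂μ) ^ 2‖
        = Real.sqrt n * (mcMean n (fun m => Y ℓ m ω) f - ∫ y, f y ∂μ) ^ 2 := fun ω =>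
      Real.norm_of_nonneg (by positivity)
    simp only [this, integral_const_mul, hint n hn]
    have h2 := Real.mul_self_sqrt hn0.le
    have h3 : Real.sqrt n ≠ 0 := by positivity
    rw [div_eq_iff h3]
    field_simp
    rw [Real.sq_sqrt hn0.le]
  refine Tendsto.congr' hnorm ?_
  rw [← ENNReal.ofReal_zero]
  exact ENNReal.tendsto_ofReal (tendsto_const_nhds.div_atTop
    (Real.tendsto_sqrt_atTop.comp tendsto_natCast_atTop_atTop))

/-- The limit in the outermost variable, where only the level-`0` means are still random. -/
theorem tendsto_measure_hybridGap_one_nonpos (hY : IsSampleArray P μ Y)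
    (h𝒜 : IsRegularAlgebra 𝒜 μ B) (hs : ∀ ℓ, s ℓ ∈ 𝒜)
    (hvar : 0 < variance (level (sqDev s (∫ y, s 0 y ∂μ)) 0) μ) {a : ℝ} (ha : 0 < a)
    (M : Fin (L + 1) → ℕ) :
    Tendsto (fun m => P.real {ω |
        hybridGap μ s a 1 (Function.update M 0 m) (fun ℓ m => Y ℓ m ω) ≤ 0}) atTop
      (𝓝 (erf (a / Real.sqrt 2))) := by
  obtain ⟨c₀, hc₀⟩ : ∃ c, ∫ y, s 0 y ∂μ = c := ⟨_, rfl⟩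
  obtain ⟨f, hf_def⟩ : ∃ f, f = level s 0 := ⟨_, rfl⟩
  obtain ⟨g, hg_def⟩ : ∃ g, g = level (s ^ 2) 0 := ⟨_, rfl⟩
  obtain ⟨h, hh_def⟩ : ∃ h : Θ → ℝ, h = fun y => g y - 2 * c₀ * f y := ⟨_, rfl⟩
  have hf : f ∈ 𝒜 := hf_def ▸ level_mem hs 0
  have hg : g ∈ 𝒜 := hg_def ▸ level_mem (f := s ^ 2) (fun ℓ => pow_mem (hs ℓ) 2) 0
  have hh : h ∈ 𝒜 := hh_def ▸ sub_mem hg (mul_mem (const_mem (2 * c₀)) hf)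
  have hfm := h𝒜.measurable f hf
  have hgm := h𝒜.measurable g hg
  have hhm := h𝒜.measurable h hh
  have hv : variance h μ = variance (level (sqDev s c₀) 0) μ := by
    have : level (sqDev s c₀) 0
        = fun y => h y + if (0 : Fin (L + 1)) = Fin.last L then c₀ ^ 2 else 0 := by
      rw [hh_def, hf_def, hg_def]
      exact funext (level_sqDev s c₀ 0)
    rw [this, variance_add_const hhm.aestronglyMeasurable]
  rw [hc₀, ← hv] at hvar
  obtain ⟨v, hvv⟩ : ∃ v : ℝ≥0, (v : ℝ) = variance h μ := ⟨⟨_, hvar.le⟩, rfl⟩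
  have hv0 : v ≠ 0 := by
    rintro rfl
    simp [← hvv] at hvar
  have hsm : ∀ {φ : Θ → ℝ}, Measurable φ → ∀ n,
      Measurable fun ω => mcMean n (fun m => Y 0 m ω) φ := fun {φ} hφ n =>
    mcMean_mem (𝒟 := measurableSubalgebra Ω) n (x := fun ω m => Y 0 m ω) (h := fun _ => φ)
      fun m => hφ.comp (hY.measurable 0 m)
  have hT : TendstoInDistribution
      (fun (n : ℕ) ω => Real.sqrt n * (mcMean n (fun m => Y 0 m ω) h - ∫ y, h y ∂μ)) atTop
      (id : ℝ → ℝ) (fun _ => P) (gaussianReal 0 v) := by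
    have hlaw : HasLaw (id : ℝ → ℝ) (gaussianReal 0
        (variance (fun ω => h (Y 0 0 ω)) P).toNNReal) (gaussianReal 0 v) := by
      rw [hY.variance_comp 0 0 hhm, ← hvv, Real.toNNReal_coe]
      exact HasLaw.id
    have := tendstoInDistribution_inv_sqrt_mul_sum_sub
      (X := fun m ω => h (Y 0 m ω)) hlaw
      ((h𝒜.memLp_two hh).comp_measurePreserving (hY.measurePreserving 0 0))
      (hY.iIndepFun_comp 0 hhm) (hY.identDistrib_comp 0 hhm)
    rw [hY.integral_comp 0 0 hhm] at this
    refine this.congr (fun n => .of_forall fun ω => ?_) (Filter.EventuallyEq.refl _ _)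
    rcases Nat.eq_zero_or_pos n with rfl | hn
    · simp
    have hn0 : (0 : ℝ) < n := by positivity
    have h3 : Real.sqrt n ≠ 0 := by positivity
    simp only [mcMean]
    field_simp
    rw [Real.sq_sqrt hn0.le]
  have hCm : ∀ n, Measurable fun ω => mcMean n (fun m => Y 0 m ω) f - (∫ y, f y ∂μ) + c₀ :=
    fun n => ((hsm hfm n).sub_const _).add_const _
  have hSm : ∀ n, Measurable fun ω => mcVar n (fun m => Y 0 m ω) (fun y =>
      g y - 2 * (mcMean n (fun m => Y 0 m ω) f - (∫ y, f y ∂μ) + c₀) * f y) := fun n =>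
    mcVar_mem (𝒟 := measurableSubalgebra Ω) n (x := fun ω m => Y 0 m ω)
      (h := fun ω y => g y - 2 * (mcMean n (fun m => Y 0 m ω) f - (∫ y, f y ∂μ) + c₀) * f y)
      fun m => (hgm.comp (hY.measurable 0 m)).sub
        (((hCm n).const_mul 2).mul (hfm.comp (hY.measurable 0 m)))
  have hS : TendstoInMeasure P (fun n ω => mcVar n (fun m => Y 0 m ω) (fun y =>
      g y - 2 * (mcMean n (fun m => Y 0 m ω) f - (∫ y, f y ∂μ) + c₀) * f y)) atTop
      fun _ => (v : ℝ) := by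
    refine tendstoInMeasure_of_tendsto_ae (fun n => (hSm n).aestronglyMeasurable) ?_
    filter_upwards [hY.ae_momentsConverge h𝒜 0 hf hg] with ω hω
    have hC : Tendsto (fun n => mcMean n (fun m => Y 0 m ω) f - (∫ y, f y ∂μ) + c₀) atTop
        (𝓝 c₀) := by
      simpa using (hω.fst.sub_const (∫ y, f y ∂μ)).add_const c₀
    rw [hvv, hh_def]
    exact tendsto_mcVar_sub_mul (h𝒜.integrable _ hf) (h𝒜.integrable _ hg)
      (h𝒜.integrable _ (mul_mem hf hf)) (h𝒜.integrable _ (mul_mem hf hg))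
      (h𝒜.integrable _ (mul_mem hg hg)) hω hC
  refine (tendsto_measure_sq_sub_nonpos hv0 ha hT (hY.tendstoInMeasure_sqrt_mul_sq h𝒜 0 hf) hS
    (fun n => ((hsm hhm n).sub_const _).const_mul _)
    (fun n => (((hsm hfm n).sub_const _).pow_const 2).const_mul _) hSm).congr' ?_
  filter_upwards [eventually_gt_atTop 0] with n hn
  have hn0 : (0 : ℝ) < n := by positivity
  refine congrArg P.real (Set.ext fun ω => ?_)
  have key := natCast_mul_hybridGap_one h𝒜 hs a M (fun ℓ m => Y ℓ m ω) n hc₀ hf_def hg_def hh_def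
  rw [Set.mem_ofPred_eq, Set.mem_ofPred_eq, ← key]
  exact ⟨fun hle => nonpos_of_mul_nonpos_right hle hn0,
    fun hle => mul_nonpos_of_nonneg_of_nonpos hn0.le hle⟩

end IsSampleArray

end CentralLimit

/-! ### Rational dependence of the outputs on the parameter -/

section Rational

variable (𝕜 : Type*) [RCLike 𝕜] {Q : ℕ} (Λ : Set (Fin Q → ℝ))

/-- The value of a polynomial with coefficients in `𝕜` at a real point. -/
def evalAt (p : MvPolynomial (Fin Q) 𝕜) (y : Fin Q → ℝ) : 𝕜 :=
  MvPolynomial.eval (fun q => (y q : 𝕜)) p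

theorem continuous_evalAt (p : MvPolynomial (Fin Q) 𝕜) : Continuous (evalAt 𝕜 p) :=
  p.continuous_eval.comp (continuous_pi fun q => RCLike.continuous_ofReal.comp (continuous_apply q))

/-- The functions that agree on `Λ` with a quotient of polynomials whose denominator has no zero on
`Λ`. Their values outside `Λ` are arbitrary. -/
def rationalOn : Subalgebra 𝕜 ((Fin Q → ℝ) → 𝕜) where
  carrier := {h | ∃ p q : MvPolynomial (Fin Q) 𝕜, ∀ y ∈ Λ, evalAt 𝕜 q y ≠ 0 ∧
    h y = evalAt 𝕜 p y / evalAt 𝕜 q y}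
  mul_mem' := by
    rintro f g ⟨p, q, h⟩ ⟨p', q', h'⟩
    refine ⟨p * p', q * q', fun y hy => ?_⟩
    obtain ⟨h1, h2⟩ := h y hy
    obtain ⟨h3, h4⟩ := h' y hy
    simp only [evalAt, map_mul] at *
    exact ⟨mul_ne_zero h1 h3, by rw [Pi.mul_apply, h2, h4, div_mul_div_comm]⟩
  add_mem' := by
    rintro f g ⟨p, q, h⟩ ⟨p', q', h'⟩
    refine ⟨p * q' + q * p', q * q', fun y hy => ?_⟩
    obtain ⟨h1, h2⟩ := h y hy
    obtain ⟨h3, h4⟩ := h' y hy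
    simp only [evalAt, map_mul, map_add] at *
    exact ⟨mul_ne_zero h1 h3, by rw [Pi.add_apply, h2, h4, div_add_div _ _ h1 h3]⟩
  algebraMap_mem' c := ⟨MvPolynomial.C c, 1, fun y _ => by simp [evalAt]⟩

variable {𝕜 Λ}

theorem rationalOn_congr {f g : (Fin Q → ℝ) → 𝕜} (hf : f ∈ rationalOn 𝕜 Λ)
    (h : ∀ y ∈ Λ, g y = f y) : g ∈ rationalOn 𝕜 Λ := by
  obtain ⟨p, q, hpq⟩ := hf
  exact ⟨p, q, fun y hy => ⟨(hpq y hy).1, (h y hy).trans (hpq y hy).2⟩⟩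

theorem rationalOn_const (c : 𝕜) : (fun _ => c) ∈ rationalOn 𝕜 Λ :=
  (rationalOn 𝕜 Λ).algebraMap_mem c

theorem rationalOn_coord (i : Fin Q) : (fun y => (y i : 𝕜)) ∈ rationalOn 𝕜 Λ :=
  ⟨MvPolynomial.X i, 1, fun y _ => by simp [evalAt]⟩

theorem rationalOn_sum {ι : Type*} (S : Finset ι) {f : ι → (Fin Q → ℝ) → 𝕜}
    (hf : ∀ i ∈ S, f i ∈ rationalOn 𝕜 Λ) : (fun y => ∑ i ∈ S, f i y) ∈ rationalOn 𝕜 Λ := by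
  have : (fun y => ∑ i ∈ S, f i y) = ∑ i ∈ S, f i := by funext y; simp
  rw [this]
  exact sum_mem hf

theorem rationalOn_inv {f : (Fin Q → ℝ) → 𝕜} (hf : f ∈ rationalOn 𝕜 Λ)
    (h0 : ∀ y ∈ Λ, f y ≠ 0) : (fun y => (f y)⁻¹) ∈ rationalOn 𝕜 Λ := by
  obtain ⟨p, q, h⟩ := hf
  refine ⟨q, p, fun y hy => ⟨fun hp => h0 y hy ?_, by
    simp only [(h y hy).2, inv_div]⟩⟩
  rw [(h y hy).2, hp, zero_div]

theorem evalAt_map_conj (p : MvPolynomial (Fin Q) 𝕜) (y : Fin Q → ℝ) :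
    evalAt 𝕜 (MvPolynomial.map (starRingEnd 𝕜) p) y = starRingEnd 𝕜 (evalAt 𝕜 p y) := by
  induction p using MvPolynomial.induction_on with
  | C c => simp [evalAt]
  | add p q hp hq => simp only [evalAt, map_add] at *; rw [hp, hq]
  | mul_X p i hp => simp only [evalAt, map_mul] at *; rw [hp]; simp

theorem rationalOn_conj {f : (Fin Q → ℝ) → 𝕜} (hf : f ∈ rationalOn 𝕜 Λ) :
    (fun y => starRingEnd 𝕜 (f y)) ∈ rationalOn 𝕜 Λ := by
  obtain ⟨p, q, h⟩ := hf
  refine ⟨MvPolynomial.map (starRingEnd 𝕜) p, MvPolynomial.map (starRingEnd 𝕜) q,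
    fun y hy => ?_⟩
  simp only [evalAt_map_conj, (h y hy).2, map_div₀]
  exact ⟨(map_ne_zero _).2 (h y hy).1, trivial⟩

theorem rationalOn_re {f : (Fin Q → ℝ) → 𝕜} (hf : f ∈ rationalOn 𝕜 Λ) :
    (fun y => ((RCLike.re (f y) : ℝ) : 𝕜)) ∈ rationalOn 𝕜 Λ := by
  refine rationalOn_congr (mul_mem (add_mem hf (rationalOn_conj hf)) (rationalOn_const (2 : 𝕜)⁻¹))
    fun y _ => ?_
  simp only [Pi.mul_apply, Pi.add_apply]
  rw [RCLike.re_eq_add_conj, div_eq_mul_inv]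

theorem rationalOn_det {n : ℕ} {A : (Fin Q → ℝ) → Matrix (Fin n) (Fin n) 𝕜}
    (hA : ∀ i j, (fun y => A y i j) ∈ rationalOn 𝕜 Λ) :
    (fun y => (A y).det) ∈ rationalOn 𝕜 Λ := by
  simp only [Matrix.det_apply']
  refine rationalOn_sum _ fun σ _ => mul_mem (rationalOn_const _) ?_
  have : (fun y => ∏ i, A y (σ i) i) = ∏ i, fun y => A y (σ i) i := by funext y; simp
  rw [this]
  exact prod_mem fun i _ => hA _ _

/-- By Cramer's rule, the solution of a linear system depends rationally on the parameter if the
matrix does and is injective on `Λ`. -/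
theorem rationalOn_of_mulVec_eq {n : ℕ} {A : (Fin Q → ℝ) → Matrix (Fin n) (Fin n) 𝕜}
    {b : Fin n → 𝕜} {x : (Fin Q → ℝ) → Fin n → 𝕜}
    (hA : ∀ i j, (fun y => A y i j) ∈ rationalOn 𝕜 Λ)
    (hinj : ∀ y ∈ Λ, ∀ v, (A y).mulVec v = 0 → v = 0) (hx : ∀ y ∈ Λ, (A y).mulVec (x y) = b)
    (j : Fin n) : (fun y => x y j) ∈ rationalOn 𝕜 Λ := by
  have hdet : ∀ y ∈ Λ, (A y).det ≠ 0 := fun y hy h0 => by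
    obtain ⟨v, hv, hv0⟩ := Matrix.exists_mulVec_eq_zero_iff.2 h0
    exact hv (hinj y hy v hv0)
  have hcr : (fun y => ((A y).updateCol j b).det) ∈ rationalOn 𝕜 Λ := by
    refine rationalOn_det fun i k => ?_
    simp only [Matrix.updateCol_apply]
    split_ifs
    · exact rationalOn_const _
    · exact hA i k
  refine rationalOn_congr (mul_mem (rationalOn_inv (rationalOn_det hA) hdet) hcr) fun y hy => ?_
  have h1 : (A y).cramer b = (A y).det • x y := by
    rw [Matrix.cramer_eq_adjugate_mulVec, ← hx y hy, Matrix.mulVec_mulVec, Matrix.adjugate_mul,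
      Matrix.smul_mulVec, Matrix.one_mulVec]
  have h2 : ((A y).updateCol j b).det = (A y).det * x y j := by
    rw [← Matrix.cramer_apply, h1, Pi.smul_apply, smul_eq_mul]
  simp only [Pi.mul_apply]
  rw [h2, inv_mul_cancel_left₀ (hdet y hy)]

variable {W : Type*} [AddCommGroup W] [Module 𝕜 W]

/-- On `Λ`, the vector function `u` is a combination of fixed vectors with rational coefficients.
-/
def RationalVecOn (Λ : Set (Fin Q → ℝ)) (u : (Fin Q → ℝ) → W) : Prop :=
  ∃ (n : ℕ) (e : Fin n → W) (ξ : (Fin Q → ℝ) → Fin n → 𝕜),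
    (∀ j, (fun y => ξ y j) ∈ rationalOn 𝕜 Λ) ∧ ∀ y ∈ Λ, u y = ∑ j, ξ y j • e j

namespace AffineProblem

variable (A : AffineProblem 𝕜 Q W)

/-- The form `a(·, ·; y)` as a bundled sesquilinear map. -/
def formₗ (y : Fin Q → ℝ) : W →ₗ[𝕜] W →ₗ⋆[𝕜] 𝕜 := A.a₀ + ∑ q, (y q : 𝕜) • A.a₁ q

theorem formₗ_apply (y : Fin Q → ℝ) (v w : W) : A.formₗ y v w = A.form y v w := by
  simp only [formₗ, form, LinearMap.add_apply, LinearMap.sum_apply, LinearMap.smul_apply,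
    smul_eq_mul]

theorem rationalOn_form (v w : W) : (fun y => A.form y v w) ∈ rationalOn 𝕜 Λ :=
  add_mem (rationalOn_const _)
    (rationalOn_sum _ fun i _ => mul_mem (rationalOn_coord i) (rationalOn_const _))

theorem isPrimal_primal {V : Submodule 𝕜 W} {y : Fin Q → ℝ} (h : ∃ u, A.IsPrimal V y u) :
    A.IsPrimal V y (A.primal V y) := by
  rw [primal, dif_pos h]; exact h.choose_spec

theorem isDual_dual {V : Submodule 𝕜 W} {y : Fin Q → ℝ} (h : ∃ u, A.IsDual V y u) :
    A.IsDual V y (A.dual V y) := by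
  rw [dual, dif_pos h]; exact h.choose_spec

theorem rationalVecOn_primal [FiniteDimensional 𝕜 W] (V : Submodule 𝕜 W)
    (h : ∀ y ∈ Λ, ∃! u, A.IsPrimal V y u) : RationalVecOn (𝕜 := 𝕜) Λ (A.primal V) := by
  classical
  let e := Module.finBasis 𝕜 V
  let x : (Fin Q → ℝ) → Fin (Module.finrank 𝕜 V) → 𝕜 := fun y j =>
    if hy : A.primal V y ∈ V then e.repr ⟨A.primal V y, hy⟩ j else 0
  have hexp : ∀ y ∈ Λ, A.primal V y = ∑ j, x y j • (e j : W) := fun y hy => by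
    have hmem := (A.isPrimal_primal (h y hy).exists).1
    have := congrArg (Subtype.val) (e.sum_repr ⟨A.primal V y, hmem⟩)
    simp only [AddSubmonoidClass.coe_finsetSum, Submodule.coe_smul] at this
    simp only [x, dif_pos hmem, this]
  have hform : ∀ y (v : Fin _ → 𝕜) (w : W),
      A.form y (∑ j, v j • (e j : W)) w = ∑ j, A.form y (e j) w * v j := fun y v w => by
    simp only [← formₗ_apply, map_sum, map_smul, LinearMap.sum_apply, LinearMap.smul_apply,
      smul_eq_mul, mul_comm]
  refine ⟨_, fun j => (e j : W), x, fun j => ?_, hexp⟩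
  refine rationalOn_of_mulVec_eq (A := fun y => Matrix.of fun i j => A.form y (e j) (e i))
    (b := fun i => A.b (e i)) (fun i j => A.rationalOn_form _ _) ?_ ?_ j
  · -- adding a kernel vector to the solution gives another solution
    intro y hy v hv
    have hsol := A.isPrimal_primal (h y hy).exists
    have hker : ∀ w ∈ V, A.form y (∑ j, v j • (e j : W)) w = 0 := fun w hw => by
      have hw' := congrArg (Subtype.val) (e.sum_repr ⟨w, hw⟩)
      simp only [AddSubmonoidClass.coe_finsetSum, Submodule.coe_smul] at hw'
      rw [← hw', ← formₗ_apply, map_sum]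
      refine Finset.sum_eq_zero fun i _ => ?_
      rw [LinearMap.map_smulₛₗ, formₗ_apply, hform]
      have := congrFun hv i
      simp only [Matrix.mulVec, dotProduct, Matrix.of_apply, Pi.zero_apply] at this
      rw [this, smul_zero]
    have hsol' : A.IsPrimal V y (A.primal V y + ∑ j, v j • (e j : W)) := by
      refine ⟨V.add_mem hsol.1 (V.sum_mem fun j _ => V.smul_mem _ (e j).2), fun w hw => ?_⟩
      have := hker w hw
      rw [← formₗ_apply] at this
      rw [← formₗ_apply, map_add, LinearMap.add_apply, this, add_zero, formₗ_apply, hsol.2 w hw]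
    have hz : ∑ j, v j • (e j : W) = 0 := by
      simpa using (h y hy).unique hsol' hsol
    have hz' : ∑ j, v j • e j = 0 := Subtype.ext (by
      simpa only [AddSubmonoidClass.coe_finsetSum, Submodule.coe_smul, ZeroMemClass.coe_zero]
        using hz)
    exact funext (Fintype.linearIndependent_iff.1 e.linearIndependent v hz')
  · intro y hy
    funext i
    have := (A.isPrimal_primal (h y hy).exists).2 (e i) (e i).2
    rw [hexp y hy, hform] at this
    simpa only [Matrix.mulVec, dotProduct, Matrix.of_apply] using this

theorem rationalVecOn_dual [FiniteDimensional 𝕜 W] (V : Submodule 𝕜 W)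
    (h : ∀ y ∈ Λ, ∃! u, A.IsDual V y u) : RationalVecOn (𝕜 := 𝕜) Λ (A.dual V) := by
  classical
  let e := Module.finBasis 𝕜 V
  let x : (Fin Q → ℝ) → Fin (Module.finrank 𝕜 V) → 𝕜 := fun y j =>
    if hy : A.dual V y ∈ V then e.repr ⟨A.dual V y, hy⟩ j else 0
  have hexp : ∀ y ∈ Λ, A.dual V y = ∑ j, x y j • (e j : W) := fun y hy => by
    have hmem := (A.isDual_dual (h y hy).exists).1
    have := congrArg (Subtype.val) (e.sum_repr ⟨A.dual V y, hmem⟩)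
    simp only [AddSubmonoidClass.coe_finsetSum, Submodule.coe_smul] at this
    simp only [x, dif_pos hmem, this]
  have hform : ∀ y (v : Fin _ → 𝕜) (w : W), A.form y w (∑ j, v j • (e j : W))
      = ∑ j, A.form y w (e j) * starRingEnd 𝕜 (v j) := fun y v w => by
    simp only [← formₗ_apply, map_sum, LinearMap.map_smulₛₗ, smul_eq_mul, mul_comm]
  -- the conjugates of the coordinates solve a linear system
  refine ⟨_, fun j => (e j : W), x, fun j => ?_, hexp⟩
  suffices (fun y => starRingEnd 𝕜 (x y j)) ∈ rationalOn 𝕜 Λ by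
    simpa using rationalOn_conj this
  refine rationalOn_of_mulVec_eq (A := fun y => Matrix.of fun i j => A.form y (e i) (e j))
    (b := fun i => -A.out (e i)) (x := fun y j => starRingEnd 𝕜 (x y j))
    (fun i j => A.rationalOn_form _ _) ?_ ?_ j
  · -- adding the vector with conjugate coordinates to the solution gives another solution
    intro y hy v hv
    have hsol := A.isDual_dual (h y hy).exists
    let v' : Fin (Module.finrank 𝕜 V) → 𝕜 := fun j => starRingEnd 𝕜 (v j)
    have hker : ∀ w ∈ V, A.form y w (∑ j, v' j • (e j : W)) = 0 := fun w hw => by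
      have hw' := congrArg (Subtype.val) (e.sum_repr ⟨w, hw⟩)
      simp only [AddSubmonoidClass.coe_finsetSum, Submodule.coe_smul] at hw'
      rw [← hw', ← formₗ_apply, map_sum (A.formₗ y), LinearMap.sum_apply]
      refine Finset.sum_eq_zero fun i _ => ?_
      rw [map_smul, LinearMap.smul_apply, formₗ_apply, hform]
      have := congrFun hv i
      simp only [Matrix.mulVec, dotProduct, Matrix.of_apply, Pi.zero_apply] at this
      simp only [v', RCLike.conj_conj, this, smul_zero]
    have hsol' : A.IsDual V y (A.dual V y + ∑ j, v' j • (e j : W)) := by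
      refine ⟨V.add_mem hsol.1 (V.sum_mem fun j _ => V.smul_mem _ (e j).2), fun w hw => ?_⟩
      have := hker w hw
      rw [← formₗ_apply] at this
      rw [← formₗ_apply, map_add, this, add_zero, formₗ_apply, hsol.2 w hw]
    have hz : ∑ j, v' j • (e j : W) = 0 := by
      simpa using (h y hy).unique hsol' hsol
    have hz' : ∑ j, v' j • e j = 0 := Subtype.ext (by
      simpa only [AddSubmonoidClass.coe_finsetSum, Submodule.coe_smul, ZeroMemClass.coe_zero]
        using hz)
    have := Fintype.linearIndependent_iff.1 e.linearIndependent v' hz'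
    exact funext fun j => (map_eq_zero (starRingEnd 𝕜)).1 (this j)
  · intro y hy
    funext i
    have := (A.isDual_dual (h y hy).exists).2 (e i) (e i).2
    rw [hexp y hy, hform] at this
    simpa only [Matrix.mulVec, dotProduct, Matrix.of_apply] using this

theorem rationalOn_out {u : (Fin Q → ℝ) → W} (hu : RationalVecOn (𝕜 := 𝕜) Λ u) :
    (fun y => A.out (u y)) ∈ rationalOn 𝕜 Λ := by
  obtain ⟨n, e, ξ, hξ, h⟩ := hu
  refine rationalOn_congr (rationalOn_sum Finset.univ fun j _ =>
    mul_mem (hξ j) (rationalOn_const (A.out (e j)))) fun y hy => ?_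
  simp [h y hy]

theorem rationalOn_b {φ : (Fin Q → ℝ) → W} (hφ : RationalVecOn (𝕜 := 𝕜) Λ φ) :
    (fun y => A.b (φ y)) ∈ rationalOn 𝕜 Λ := by
  obtain ⟨n, e, ξ, hξ, h⟩ := hφ
  refine rationalOn_congr (rationalOn_sum Finset.univ fun j _ =>
    mul_mem (rationalOn_conj (hξ j)) (rationalOn_const (A.b (e j)))) fun y hy => ?_
  simp [h y hy, LinearMap.map_smulₛₗ]

theorem rationalOn_form_comp {u φ : (Fin Q → ℝ) → W} (hu : RationalVecOn (𝕜 := 𝕜) Λ u)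
    (hφ : RationalVecOn (𝕜 := 𝕜) Λ φ) : (fun y => A.form y (u y) (φ y)) ∈ rationalOn 𝕜 Λ := by
  obtain ⟨n, e, ξ, hξ, h⟩ := hu
  obtain ⟨n', e', η, hη, h'⟩ := hφ
  refine rationalOn_congr (rationalOn_sum Finset.univ fun i _ => mul_mem (hξ i)
    (rationalOn_sum Finset.univ fun j _ => mul_mem (rationalOn_conj (hη j))
      (A.rationalOn_form (e i) (e' j)))) fun y hy => ?_
  simp only [h y hy, h' y hy, Pi.mul_apply, ← formₗ_apply]
  rw [map_sum (A.formₗ y), LinearMap.sum_apply]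
  simp only [map_smul, LinearMap.smul_apply, map_sum, LinearMap.map_smulₛₗ, smul_eq_mul,
    Finset.mul_sum, mul_left_comm]

end AffineProblem

theorem rationalOn_outputs [FiniteDimensional 𝕜 W] (A : AffineProblem 𝕜 Q W) (zpr zdu : ℕ → W)
    {L : ℕ} (N : Fin L → ℕ) (h_full : ∀ y ∈ Λ, ∃! u, A.IsPrimal ⊤ y u)
    (h_pr : ∀ ℓ, ∀ y ∈ Λ, ∃! u, A.IsPrimal (rbSpace 𝕜 zpr (N ℓ)) y u)
    (h_du : ∀ ℓ, ∀ y ∈ Λ, ∃! φ, A.IsDual (rbSpace 𝕜 zdu (N ℓ)) y φ) (ℓ : Fin (L + 1)) :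
    (fun y => (outputs A zpr zdu N ℓ y : 𝕜)) ∈ rationalOn 𝕜 Λ := by
  cases ℓ using Fin.cases with
  | zero => exact rationalOn_re (A.rationalOn_out (A.rationalVecOn_primal ⊤ h_full))
  | succ i =>
    have hu := A.rationalVecOn_primal _ (h_pr i)
    have hφ := A.rationalVecOn_dual _ (h_du i)
    exact rationalOn_re (sub_mem (add_mem (A.rationalOn_out hu) (A.rationalOn_form_comp hu hφ))
      (A.rationalOn_b hφ))

end Rational

/-! ### The parameter law -/

section Law

variable {Q : ℕ} {γ : Fin Q → ℝ} {ρ : Fin Q → ℝ → ℝ≥0}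

/-- The law `ρ q (t) dt` of the `q`-th component of the parameter. -/
def coordLaw (γ : Fin Q → ℝ) (ρ : Fin Q → ℝ → ℝ≥0) (q : Fin Q) : Measure ℝ :=
  (volume.restrict (Set.Icc (-γ q) (γ q))).withDensity fun t => (ρ q t : ℝ≥0∞)

theorem paramLaw_eq_pi (γ : Fin Q → ℝ) (ρ : Fin Q → ℝ → ℝ≥0) :
    paramLaw γ ρ = Measure.pi (coordLaw γ ρ) := rfl

theorem isProbabilityMeasure_coordLaw
    (hρ : ∀ q, ∫⁻ t in Set.Icc (-γ q) (γ q), (ρ q t : ℝ≥0∞) = 1) (q : Fin Q) :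
    IsProbabilityMeasure (coordLaw γ ρ q) :=
  ⟨by rw [coordLaw, withDensity_apply _ MeasurableSet.univ, Measure.restrict_univ, hρ q]⟩

theorem isProbabilityMeasure_paramLaw
    (hρ : ∀ q, ∫⁻ t in Set.Icc (-γ q) (γ q), (ρ q t : ℝ≥0∞) = 1) :
    IsProbabilityMeasure (paramLaw γ ρ) := by
  have := isProbabilityMeasure_coordLaw hρ
  rw [paramLaw_eq_pi]
  infer_instance

theorem measurePreserving_eval_paramLaw
    (hρ : ∀ q, ∫⁻ t in Set.Icc (-γ q) (γ q), (ρ q t : ℝ≥0∞) = 1) (q : Fin Q) :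
    MeasurePreserving (fun y : Fin Q → ℝ => y q) (paramLaw γ ρ) (coordLaw γ ρ q) := by
  have := isProbabilityMeasure_coordLaw hρ
  exact measurePreserving_eval (coordLaw γ ρ) q

theorem ae_mem_box (hρ : ∀ q, ∫⁻ t in Set.Icc (-γ q) (γ q), (ρ q t : ℝ≥0∞) = 1) :
    ∀ᵐ y ∂paramLaw γ ρ, y ∈ box γ := by
  have h : ∀ q, ∀ᵐ y ∂paramLaw γ ρ, y q ∈ Set.Icc (-γ q) (γ q) := fun q => by
    refine (measurePreserving_eval_paramLaw hρ q).quasiMeasurePreserving.ae ?_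
    exact (withDensity_absolutelyContinuous _ _).ae_le (ae_restrict_mem measurableSet_Icc)
  filter_upwards [ae_all_iff.2 h] with y hy
  exact fun q _ => hy q

variable {𝕜 : Type*} [RCLike 𝕜]

/-- Freezing all variables but one leaves a polynomial in that variable. -/
theorem exists_polynomial_eval_eq_evalAt_update (p : MvPolynomial (Fin Q) 𝕜) (y : Fin Q → ℝ)
    (i : Fin Q) :
    ∃ r : Polynomial 𝕜, ∀ t : ℝ, evalAt 𝕜 p (Function.update y i t) = r.eval (t : 𝕜) := by
  induction p using MvPolynomial.induction_on with
  | C c => exact ⟨Polynomial.C c, fun t => by simp [evalAt]⟩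
  | add p q hp hq =>
    obtain ⟨r, hr⟩ := hp
    obtain ⟨r', hr'⟩ := hq
    refine ⟨r + r', fun t => ?_⟩
    rw [Polynomial.eval_add, ← hr, ← hr', evalAt, map_add]
    rfl
  | mul_X p j hp =>
    obtain ⟨r, hr⟩ := hp
    rcases eq_or_ne j i with rfl | hj
    · refine ⟨r * Polynomial.X, fun t => ?_⟩
      rw [Polynomial.eval_mul, ← hr, evalAt, map_mul]
      simp [evalAt]
    · refine ⟨r * Polynomial.C (y j : 𝕜), fun t => ?_⟩
      rw [Polynomial.eval_mul, ← hr, evalAt, map_mul]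
      simp [evalAt, hj]

/-- The zero set of a nonzero polynomial is null for the parameter law. -/
theorem ae_evalAt_ne_zero (hρ : ∀ q, ∫⁻ t in Set.Icc (-γ q) (γ q), (ρ q t : ℝ≥0∞) = 1)
    (p : MvPolynomial (Fin Q) 𝕜) {y₀ : Fin Q → ℝ} (hp : evalAt 𝕜 p y₀ ≠ 0) :
    ∀ᵐ y ∂paramLaw γ ρ, evalAt 𝕜 p y ≠ 0 := by
  classical
  have := isProbabilityMeasure_coordLaw hρ
  have := isProbabilityMeasure_paramLaw hρ
  refine ae_ne_zero_of_sections (Y := fun q (y : Fin Q → ℝ) => y q) (P := paramLaw γ ρ)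
    (fun q => measurable_pi_apply q)
    (iIndepFun_pi (μ := coordLaw γ ρ) (X := fun (_ : Fin Q) (t : ℝ) => t) fun q => aemeasurable_id)
    (𝒜 := {f : ℝ → 𝕜 | ∃ r : Polynomial 𝕜, ∀ t, f t = r.eval (t : 𝕜)}) (B := Set.univ)
    (fun c => ⟨Polynomial.C c, by simp⟩) ?_ (fun _ => Set.mem_univ _) Finset.univ (evalAt 𝕜 p)
    (continuous_evalAt 𝕜 p).measurable ?_
    (fun y y' h => congrArg _ (funext fun i => h i (Finset.mem_univ i))) hp
  · rintro q f ⟨r, hr⟩ ⟨t, -, ht⟩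
    have hr0 : r ≠ 0 := by rintro rfl; simp [hr] at ht
    have hfin : {t : ℝ | f t = 0}.Finite := by
      refine Set.Finite.subset ((r.rootSet_finite 𝕜).preimage
        (f := fun t : ℝ => (t : 𝕜)) RCLike.ofReal_injective.injOn) fun u hu => ?_
      simp only [Set.mem_preimage]
      rw [Polynomial.mem_rootSet]
      exact ⟨hr0, by simpa [Polynomial.aeval_def, hr] using hu⟩
    have hmap : (paramLaw γ ρ).map (fun y => y q) ≪ volume := by
      rw [(measurePreserving_eval_paramLaw hρ q).map_eq]
      exact (withDensity_absolutelyContinuous _ _).trans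
        Measure.restrict_le_self.absolutelyContinuous
    have h0 : ∀ᵐ t, f t ≠ 0 := by
      rw [ae_iff]
      simpa using hfin.measure_zero volume
    exact hmap.ae_le h0
  · exact fun y i => exists_polynomial_eval_eq_evalAt_update p y i

variable (𝕜) in
/-- The measurable real functions that are rational on `Λ`. The coefficients are taken in `𝕜`,
which spares the passage to real numerators and denominators. -/
def regularFunctions (Λ : Set (Fin Q → ℝ)) : Subalgebra ℝ ((Fin Q → ℝ) → ℝ) where
  carrier := {f | Measurable f ∧ (fun y => (f y : 𝕜)) ∈ rationalOn 𝕜 Λ}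
  mul_mem' := by
    rintro f g ⟨h1, h2⟩ ⟨h3, h4⟩
    refine ⟨h1.mul h3, rationalOn_congr (mul_mem h2 h4) fun y _ => by simp⟩
  add_mem' := by
    rintro f g ⟨h1, h2⟩ ⟨h3, h4⟩
    refine ⟨h1.add h3, rationalOn_congr (add_mem h2 h4) fun y _ => by simp⟩
  algebraMap_mem' c := ⟨measurable_const, rationalOn_const (c : 𝕜)⟩

theorem isRegularAlgebra_regularFunctions
    (hρ : ∀ q, ∫⁻ t in Set.Icc (-γ q) (γ q), (ρ q t : ℝ≥0∞) = 1) :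
    IsRegularAlgebra (regularFunctions 𝕜 (box γ)) (paramLaw γ ρ) (box γ) where
  measurable f hf := hf.1
  integrable := by
    rintro f ⟨hf, p, q, h⟩
    have := isProbabilityMeasure_paramLaw hρ
    have hcomp : IsCompact (box γ) := isCompact_univ_pi fun q => isCompact_Icc
    have hcont : ContinuousOn (fun y => evalAt 𝕜 p y / evalAt 𝕜 q y) (box γ) :=
      (continuous_evalAt 𝕜 p).continuousOn.div (continuous_evalAt 𝕜 q).continuousOn
        fun y hy => (h y hy).1
    obtain ⟨C, hC⟩ := hcomp.exists_bound_of_continuousOn hcont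
    refine Integrable.of_bound hf.aestronglyMeasurable C ?_
    filter_upwards [ae_mem_box hρ] with y hy
    have := hC y hy
    rwa [← (h y hy).2, RCLike.norm_ofReal, ← Real.norm_eq_abs] at this
  ae_mem := ae_mem_box hρ
  ae_ne_zero := by
    rintro f ⟨hf, p, q, h⟩ ⟨y₀, hy₀, hne⟩
    have hp : evalAt 𝕜 p y₀ ≠ 0 := fun h0 => hne (by
      have := (h y₀ hy₀).2
      rwa [h0, zero_div, RCLike.ofReal_eq_zero] at this)
    filter_upwards [ae_evalAt_ne_zero hρ p hp, ae_mem_box hρ] with y hy hyB h0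
    have := (h y hyB).2
    simp only [h0, RCLike.ofReal_zero] at this
    exact div_ne_zero hy (h y hyB).1 this.symm

/-- The outputs need not be measurable outside the parameter box; on it they agree with measurable
functions. -/
theorem exists_mem_regularFunctions {Λ : Set (Fin Q → ℝ)} {f : (Fin Q → ℝ) → ℝ}
    (hf : (fun y => (f y : 𝕜)) ∈ rationalOn 𝕜 Λ) :
    ∃ g ∈ regularFunctions 𝕜 Λ, ∀ y ∈ Λ, g y = f y := by
  obtain ⟨p, q, h⟩ := hf
  have hg : ∀ y ∈ Λ, RCLike.re (evalAt 𝕜 p y / evalAt 𝕜 q y) = f y := fun y hy => by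
    rw [← (h y hy).2, RCLike.ofReal_re]
  refine ⟨fun y => RCLike.re (evalAt 𝕜 p y / evalAt 𝕜 q y), ⟨?_, ?_⟩, hg⟩
  · exact RCLike.continuous_re.measurable.comp
      ((continuous_evalAt 𝕜 p).measurable.div (continuous_evalAt 𝕜 q).measurable)
  · exact rationalOn_congr ⟨p, q, h⟩ fun y hy => by simp only [hg y hy]

end Law


/-! ### The iterated limit -/

/-- The iterated limit for arbitrary outputs in a regular algebra; that they come from a
variational problem plays no further role. -/
theorem isIteratedLimit_measure_mlVar {Ω Θ : Type*} [MeasurableSpace Ω] [MeasurableSpace Θ] {L : ℕ}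
    {P : Measure Ω} [IsProbabilityMeasure P] {μ : Measure Θ} [IsProbabilityMeasure μ]
    {Y : Fin (L + 1) → ℕ → Ω → Θ} {𝒜 : Subalgebra ℝ (Θ → ℝ)} {B : Set Θ}
    {s : Fin (L + 1) → Θ → ℝ} (hY : IsSampleArray P μ Y) (h𝒜 : IsRegularAlgebra 𝒜 μ B)
    (hs : ∀ ℓ, s ℓ ∈ 𝒜) (hvar : 0 < variance (level (sqDev s (∫ y, s 0 y ∂μ)) 0) μ)
    {a : ℝ} (ha : 0 < a) :
    IsIteratedLimit (L + 1)
      (fun M => P.real {ω | |variance (s 0) μ - mlVar M (fun ℓ m => Y ℓ m ω) s|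
        ≤ varBound a M (fun ℓ m => Y ℓ m ω) s})
      (erf (a / Real.sqrt 2)) := by
  refine isIteratedLimit_of_partialLimits (L + 1) _ (fun k M => if k = 0 then erf (a / Real.sqrt 2)
    else P.real {ω | hybridGap μ s a k M (fun ℓ m => Y ℓ m ω) ≤ 0}) _ (fun M => if_pos rfl)
    ?_ ?_ ?_
  · intro M hM
    simp only [Nat.succ_ne_zero, if_false, abs_sub_mlVar_le_varBound_iff h𝒜 hs ha M hM]
  · intro k M M' h
    simp only [fun x => hybridGap_congr (μ := μ) (s := s) a k (x := x) (x' := x) h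
      fun _ _ _ _ => rfl]
  · intro k M hM
    simp only [Nat.succ_ne_zero, if_false]
    split_ifs with hk
    · obtain rfl : k = 0 := Fin.ext hk
      exact hY.tendsto_measure_hybridGap_one_nonpos h𝒜 hs hvar ha M
    · exact hY.tendsto_measure_hybridGap_nonpos h𝒜 hs hvar a hM (Nat.pos_of_ne_zero hk)

end

end LMVR

theorem mainTheorem3 {𝕜 : Type*} [RCLike 𝕜] {W : Type*} [AddCommGroup W] [Module 𝕜 W]
    [FiniteDimensional 𝕜 W] {Q L : ℕ}
    (γ : Fin Q → ℝ) (ρ : Fin Q → ℝ → ℝ≥0) (hρ_meas : ∀ q, Measurable (ρ q))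
    (hρ : ∀ q, ∫⁻ t in Set.Icc (-γ q) (γ q), (ρ q t : ℝ≥0∞) = 1)
    (A : LMVR.AffineProblem 𝕜 Q W) (zpr zdu : ℕ → W) (N : Fin L → ℕ)
    (h_full : ∀ y ∈ LMVR.box γ, ∃! u, A.IsPrimal ⊤ y u)
    (h_pr : ∀ ℓ, ∀ y ∈ LMVR.box γ, ∃! u, A.IsPrimal (LMVR.rbSpace 𝕜 zpr (N ℓ)) y u)
    (h_du : ∀ ℓ, ∀ y ∈ LMVR.box γ, ∃! φ, A.IsDual (LMVR.rbSpace 𝕜 zdu (N ℓ)) y φ)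
    (s : Fin (L + 1) → (Fin Q → ℝ) → ℝ) (hs : s = LMVR.outputs A zpr zdu N)
    (h_var : 0 < variance
      (LMVR.level (LMVR.sqDev s (∫ y, s 0 y ∂LMVR.paramLaw γ ρ)) 0) (LMVR.paramLaw γ ρ))
    {Ω : Type*} [MeasurableSpace Ω] (P : Measure Ω) [IsProbabilityMeasure P]
    (Y : Fin (L + 1) → ℕ → Ω → (Fin Q → ℝ)) (hY_meas : ∀ ℓ m, Measurable (Y ℓ m))
    (hY_law : ∀ ℓ m, P.map (Y ℓ m) = LMVR.paramLaw γ ρ)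
    (hY_indep : iIndepFun (fun i : Fin (L + 1) × ℕ => Y i.1 i.2) P)
    (a : ℝ) (ha : 0 < a) :
    LMVR.IsIteratedLimit (L + 1)
      (fun M => P.real {ω |
        |variance (s 0) (LMVR.paramLaw γ ρ) - LMVR.mlVar M (fun ℓ m => Y ℓ m ω) s|
          ≤ LMVR.varBound a M (fun ℓ m => Y ℓ m ω) s})
      (LMVR.erf (a / Real.sqrt 2)) := by
  have hprob := LMVR.isProbabilityMeasure_paramLaw hρ
  have hY : LMVR.IsSampleArray P (LMVR.paramLaw γ ρ) Y := ⟨hY_meas, hY_law, hY_indep⟩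
  have hrat : ∀ ℓ, (fun y => (s ℓ y : 𝕜)) ∈ LMVR.rationalOn 𝕜 (LMVR.box γ) := fun ℓ =>
    hs ▸ LMVR.rationalOn_outputs A zpr zdu N h_full h_pr h_du ℓ
  -- the outputs matter only on the box, where they agree with measurable rational functions
  choose s' hs' heq using fun ℓ => LMVR.exists_mem_regularFunctions (hrat ℓ)
  have hbox := LMVR.ae_mem_box hρ
  have hae : ∀ ℓ, s' ℓ =ᵐ[LMVR.paramLaw γ ρ] s ℓ := fun ℓ => by
    filter_upwards [hbox] with y hy using heq ℓ y hy
  have hint : ∫ y, s' 0 y ∂LMVR.paramLaw γ ρ = ∫ y, s 0 y ∂LMVR.paramLaw γ ρ :=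
    integral_congr_ae (hae 0)
  have hlevel : ∀ c ℓ, ∀ y ∈ LMVR.box γ,
      LMVR.level (LMVR.sqDev s' c) ℓ y = LMVR.level (LMVR.sqDev s c) ℓ y := fun c ℓ y hy => by
    simp only [LMVR.level, LMVR.sqDev, heq _ y hy]
  have hvar' : 0 < variance (LMVR.level (LMVR.sqDev s' (∫ y, s' 0 y ∂LMVR.paramLaw γ ρ)) 0)
      (LMVR.paramLaw γ ρ) := by
    have : LMVR.level (LMVR.sqDev s' (∫ y, s 0 y ∂LMVR.paramLaw γ ρ)) 0 =ᵐ[LMVR.paramLaw γ ρ]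
        LMVR.level (LMVR.sqDev s (∫ y, s 0 y ∂LMVR.paramLaw γ ρ)) 0 := by
      filter_upwards [hbox] with y hy using hlevel _ 0 y hy
    rwa [hint, variance_congr this]
  have key := LMVR.isIteratedLimit_measure_mlVar hY
    (LMVR.isRegularAlgebra_regularFunctions (𝕜 := 𝕜) hρ) hs' hvar' ha
  have hYbox : ∀ᵐ ω ∂P, ∀ ℓ m, Y ℓ m ω ∈ LMVR.box γ := ae_all_iff.2 fun ℓ => ae_all_iff.2 fun m =>
    (hY.measurePreserving ℓ m).quasiMeasurePreserving.ae hbox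
  convert key using 2 with M
  refine measureReal_congr ?_
  filter_upwards [hYbox] with ω hω
  have hmean : LMVR.mlMean M (fun ℓ m => Y ℓ m ω) s' = LMVR.mlMean M (fun ℓ m => Y ℓ m ω) s := by
    simp only [LMVR.mlMean, LMVR.mcMean, LMVR.level, fun j ℓ m => heq j _ (hω ℓ m)]
  have hV : LMVR.mlVar M (fun ℓ m => Y ℓ m ω) s' = LMVR.mlVar M (fun ℓ m => Y ℓ m ω) s := by
    rw [LMVR.mlVar, LMVR.mlVar, hmean]
    simp only [LMVR.mlMean, LMVR.mcMean, fun c ℓ m => hlevel c ℓ _ (hω ℓ m)]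
  have hΔ : LMVR.varBound a M (fun ℓ m => Y ℓ m ω) s'
      = LMVR.varBound a M (fun ℓ m => Y ℓ m ω) s := by
    rw [LMVR.varBound, LMVR.varBound, hmean]
    simp only [LMVR.mcVar, LMVR.mcMean, fun c ℓ m => hlevel c ℓ _ (hω ℓ m)]
  refine propext ?_
  change (_ ≤ _) ↔ (_ ≤ _)
  rw [hV, hΔ, variance_congr (hae 0)]
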